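/- Let $\mathcal A$ be a (small) poset, viewed as a category with at most one arrow $\alpha\to\beta$ between any two objects. Assume that products exist conditionally in $\mathcal A$: if there is $\omega$ with $\omega\to\alpha$ and $\omega\to\alpha'$, then the product (meet) $\alpha\wedge\alpha'$ exists. Let $X^{\mathcal A}$ be the set $\mathcal A$ with the topology having the sets $U^{\beta}=\{\alpha : \alpha\to\beta\}$ as a basis, and let $\mathcal U^{\mathcal A}=\{U^{\alpha}:\alpha\in\mathcal A\}$ be its canonical open covering. For a contravariant functor $G$ from $\mathcal A$ to abelian groups, let $\widehat G$ be the induced sheaf on $X^{\mathcal A}$, $\widehat G(U)=\varprojlim_{\alpha\in U}G(\alpha)$, so that $\widehat G(U^\alpha)=G(\alpha)$. Let $C^\bullet(\mathcal U^{\mathcal A};\widehat G)$ be the Čech complex, $C^n=\prod \widehat G(U_0\cap\dots\cap U_n)$, the product being over all sequences $(U_0,\dots,U_n)$ of members of $\mathcal U^{\mathcal A}$ with non-empty intersection, and let $C^\bullet(N(\mathcal A);G_*)$ be the nerve complex, $C^n=\prod_{\alpha_0\to\dots\to\alpha_n}G(\alpha_0)$, both with the differential given by the alternating sum, with signs $(-1)^i$,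 of the maps that omit the $i$-th entry, followed by restriction. Let $$j^*: C^\bullet(\mathcal U^{\mathcal A};\widehat G)\to C^\bullet(N(\mathcal A);G_*),\qquad (j^*c)(\alpha_0\to\dots\to\alpha_n)=c(U^{\alpha_0},\dots,U^{\alpha_n})\in \widehat G(U^{\alpha_0})=G(\alpha_0).$$ Then: 1. for every $G$, the cochain map $j^*$ is a homotopy equivalence of cochain complexes, and hence induces an isomorphism in cohomology in every degree; 2. consequently, for every $n\ge 0$, the Čech cohomology $\check H^n(X^{\mathcal A};\widehat G)=\varinjlim_{\mathcal U}H^n(\mathcal U;\widehat G)$ (the direct limit being over all open coverings of $X^{\mathcal A}$) is isomorphic, naturally in $G$, to $H^n(C^\bullet(N(\mathcal A);G_*))$, by an isomorphism whose composition with the canonical map $H^n(\mathcal U^{\mathcal A};\widehat G)\to\check H^n(X^{\mathcal A};\widehat G)$ is $H^n(j^*)$; and it is isomorphic, naturally in $G$, to the topos cohomology $H^n(\mathcal A,G)=\operatorname{Ext}^n(\mathbb Z,G)$, the $n$-th right derived functor of $\operatorname{Hom}(\mathbb Z,-)$ on presheaves of abelian groups on $\mathcal A$, where $\mathbb Z$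 is the constant presheaf. -/

import Mathlib

open CategoryTheory Opposite TopologicalSpace

universe u

noncomputable section

namespace PosetCech

/-! ### Cosimplicial local systems on simplicial sets and their cochains -/

/-- A cosimplicial local system of abelian groups on a simplicial set `K`: groups `F_u` for the
simplices `u` of `K`, and for `φ : [m] ⟶ [n]` and `v ∈ K_n` a map `F(φ, v) : F_{φ^* v} ⟶ F_v`,
functorially.  Equivalently, a presheaf on the category of elements of `K`. -/
abbrev LocalSystem (K : SSet.{u}) := K.Elementsᵒᵖ ⥤ AddCommGrpCat.{u}

/-- The structure map `F(φ, v) : F_w ⟶ F_v` of a local system, where `w = φ^* v`. -/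
abbrev LocalSystem.str {K : SSet.{u}} (F : LocalSystem K) {m n : SimplexCategory} (φ : m ⟶ n)
    (v : K.obj (op n)) (w : K.obj (op m)) (h : K.map φ.op v = w) :
    F.obj (op (K.elementsMk (op m) w)) ⟶ F.obj (op (K.elementsMk (op n) v)) :=
  F.map (CategoryOfElements.homMk (K.elementsMk (op n) v) (K.elementsMk (op m) w) φ.op h).op

/-- The family `c` of sections transported by `F(φ, v)` does not depend on the way the simplex
`φ^* v` is written. -/
theorem LocalSystem.str_congr {K : SSet.{u}} (F : LocalSystem K) {m n : SimplexCategory}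
    (φ : m ⟶ n) (v : K.obj (op n)) (w : K.obj (op m)) (h : K.map φ.op v = w)
    (c : ∀ x : K.obj (op m), F.obj (op (K.elementsMk (op m) x))) :
    F.str φ v (K.map φ.op v) rfl (c _) = F.str φ v w h (c w) := by
  subst h; rfl

/-- The cosimplicial abelian group `[n] ↦ C^n(K; F) = ∏_{u ∈ K_n} F_u` of a local system, with
`(φ c)(v) = F(φ, v)(c(φ^* v))`. -/
@[simps]
def LocalSystem.cosimplicial {K : SSet.{u}} (F : LocalSystem K) :
    CosimplicialObject AddCommGrpCat.{u} where
  obj n := AddCommGrpCat.of (∀ v : K.obj (op n), F.obj (op (K.elementsMk (op n) v)))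
  map {m n} φ := AddCommGrpCat.ofHom
    { toFun := fun c v => F.str φ v (K.map φ.op v) rfl (c (K.map φ.op v))
      map_zero' := by ext v; simp
      map_add' := fun c c' => by ext v; simp }
  map_id n := by
    ext c v
    have h : K.map (𝟙 n : n ⟶ n).op v = v := by simp
    change F.str (𝟙 n) v (K.map (𝟙 n : n ⟶ n).op v) rfl (c _) = c v
    rw [F.str_congr (𝟙 n) v v h c]
    have : F.str (𝟙 n) v v h = 𝟙 _ := F.map_id _
    rw [this]; rfl
  map_comp {l m n} φ ψ := by
    ext c v
    have h : K.map (φ ≫ ψ).op v = K.map φ.op (K.map ψ.op v) := by simp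
    change F.str (φ ≫ ψ) v _ rfl (c _) = F.str ψ v _ rfl (F.str φ _ _ rfl (c _))
    rw [F.str_congr (φ ≫ ψ) v _ h c]
    have : F.str (φ ≫ ψ) v _ h = F.str φ (K.map ψ.op v) _ rfl ≫ F.str ψ v _ rfl :=
      F.map_comp
        (CategoryOfElements.homMk (K.elementsMk (op m) (K.map ψ.op v))
          (K.elementsMk (op l) (K.map φ.op (K.map ψ.op v))) φ.op rfl).op
        (CategoryOfElements.homMk (K.elementsMk (op n) v)
          (K.elementsMk (op m) (K.map ψ.op v)) ψ.op rfl).op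
    rw [this]; rfl

/-- The functor `u ↦ f u` between categories of simplices induced by a simplicial map `f`. -/
def elementsMap {K L : SSet.{u}} (f : K ⟶ L) : K.Elements ⥤ L.Elements where
  obj x := L.elementsMk x.1 (f.app x.1 x.2)
  map {x y} g := CategoryOfElements.homMk _ _ g.1 (by
    have h := NatTrans.naturality_apply f g.1 x.2
    rw [g.2] at h
    exact h.symm)

/-- The map of cosimplicial groups `c ↦ (u ↦ t_u (c (f u)))` induced by a simplicial map
`f : K ⟶ L` and a lift `t_u : G_{f u} ⟶ F_u` of `f` to local systems. -/
@[simps]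
def LocalSystem.cosimplicialMap {K L : SSet.{u}} (f : K ⟶ L) {G : LocalSystem L}
    {F : LocalSystem K} (t : (elementsMap f).op ⋙ G ⟶ F) :
    G.cosimplicial ⟶ F.cosimplicial where
  app n := AddCommGrpCat.ofHom
    { toFun := fun c v => t.app (op (K.elementsMk (op n) v)) (c (f.app (op n) v))
      map_zero' := by ext v; exact map_zero _
      map_add' := fun c c' => by ext v; exact map_add _ _ _ }
  naturality {m n} φ := by
    ext c
    funext v
    have h : L.map φ.op (f.app (op n) v) = f.app (op m) (K.map φ.op v) :=
      (NatTrans.naturality_apply f φ.op v).symm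
    change t.app (op (K.elementsMk (op n) v)) (G.str φ (f.app (op n) v) _ rfl (c _)) =
      F.str φ v _ rfl (t.app (op (K.elementsMk (op m) (K.map φ.op v))) (c _))
    rw [G.str_congr φ _ _ h c]
    have := t.naturality (CategoryOfElements.homMk (K.elementsMk (op n) v)
      (K.elementsMk (op m) (K.map φ.op v)) φ.op rfl).op
    exact ConcreteCategory.congr_hom this (c (f.app (op m) (K.map φ.op v)))

/-- Cochains, functorially in the local system. -/
@[simps]
def cosimplicialFunctor (K : SSet.{u}) :
    LocalSystem K ⥤ CosimplicialObject AddCommGrpCat.{u} where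
  obj F := F.cosimplicial
  map {F F'} t :=
    { app := fun n => AddCommGrpCat.ofHom
        { toFun := fun c v => t.app (op (K.elementsMk (op n) v)) (c v)
          map_zero' := by ext v; exact map_zero _
          map_add' := fun c c' => by ext v; exact map_add _ _ _ }
      naturality := fun {m n} φ => by
        ext c
        funext v
        have := t.naturality (CategoryOfElements.homMk (K.elementsMk (op n) v)
          (K.elementsMk (op m) (K.map φ.op v)) φ.op rfl).op
        exact (ConcreteCategory.congr_hom this (c _)) }
  map_id F := rfl
  map_comp _ _ := rfl

/-- The cochain complex `C^•(K; F)`, with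
`(δ c)(v) = ∑ i, (-1)^i F(d_i, v)(c(d_i^* v))`, functorially in `F`. -/
abbrev cochainFunctor (K : SSet.{u}) : LocalSystem K ⥤ CochainComplex AddCommGrpCat.{u} ℕ :=
  cosimplicialFunctor K ⋙ AlgebraicTopology.alternatingCofaceMapComplex AddCommGrpCat.{u}

/-- The cochain map `C^•(L; G) ⟶ C^•(K; F)` induced by a simplicial map `f : K ⟶ L` and a lift of
`f` to the local systems. -/
abbrev cochainMap {K L : SSet.{u}} (f : K ⟶ L) {G : LocalSystem L} {F : LocalSystem K}
    (t : (elementsMap f).op ⋙ G ⟶ F) :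
    (cochainFunctor L).obj G ⟶ (cochainFunctor K).obj F :=
  (AlgebraicTopology.alternatingCofaceMapComplex AddCommGrpCat.{u}).map
    (LocalSystem.cosimplicialMap f t)

/-! ### Čech cohomology of presheaves on a topological space -/

/-- An open covering of `X`: a set of open subsets whose union is `X`. -/
structure OpenCovering (X : TopCat.{u}) where
  /-- the members of the covering -/
  sets : Set (Opens X)
  covers : ∀ x : X, ∃ U ∈ sets, x ∈ U

/-- A projection witnessing that the covering `V` refines the covering `U`. -/
@[ext]
structure Projection {X : TopCat.{u}} (U V : OpenCovering X) where
  /-- the underlying map from members of `V` to members of `U` -/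
  toFun : V.sets → U.sets
  subset : ∀ W : V.sets, (W : Opens X) ≤ toFun W

/-- Open coverings of `X`, with a morphism `U ⟶ V` for every projection from a refinement `V` of
`U`.  Since two projections from `V` to `U` induce the same map on cohomology, a colimit of Čech
cohomology groups along this category is the direct limit along the directed preorder in which
`U` precedes `V` when `V` refines `U`. -/
instance (X : TopCat.{u}) : Category (OpenCovering X) where
  Hom U V := Projection U V
  id U := ⟨id, fun _ => le_rfl⟩
  comp p q := ⟨p.toFun ∘ q.toFun, fun W => (q.subset W).trans (p.subset _)⟩

section Covering

variable {X : TopCat.{u}}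

/-- The nerve `K(U)` of a covering: `K_n(U)` consists of the sequences `(U_0, …, U_n)` of members
of `U` with non-empty intersection. -/
@[simps]
def coverNerve (U : OpenCovering X) : SSet.{u} where
  obj n := { s : Fin (n.unop.len + 1) → U.sets // ∃ x : X, ∀ i, x ∈ (s i : Opens X) }
  map φ := TypeCat.ofHom fun s =>
    ⟨fun i => s.1 (φ.unop.toOrderHom i), s.2.imp fun _ hx i => hx _⟩

/-- `(U_0, …, U_n) ↦ U_0 ∩ … ∩ U_n`, as a functor on the simplices of `K(U)`. -/
@[simps obj]
def coverInter (U : OpenCovering X) : (coverNerve U).Elements ⥤ Opens X where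
  obj s := ⨅ i, (s.2.1 i : Opens X)
  map {s t} f := homOfLE (by
    refine le_iInf fun i => ?_
    rw [← f.2]
    exact iInf_le (fun i => (s.2.1 i : Opens X)) (f.1.unop.toOrderHom i))

/-- The Čech local system on `K(U)`: `F^∨(U_0, …, U_n) = F(U_0 ∩ … ∩ U_n)`. -/
abbrev cechSystem (U : OpenCovering X) :
    TopCat.Presheaf AddCommGrpCat.{u} X ⥤ LocalSystem (coverNerve U) :=
  (Functor.whiskeringLeft _ _ _).obj (coverInter U).op

/-- The Čech complex `C^•(U; F) = C^•(K(U); F^∨)`, functorially in the presheaf `F`. -/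
abbrev cechComplex (U : OpenCovering X) :
    TopCat.Presheaf AddCommGrpCat.{u} X ⥤ CochainComplex AddCommGrpCat.{u} ℕ :=
  cechSystem U ⋙ cochainFunctor (coverNerve U)

/-- The simplicial map `K(V) ⟶ K(U)` of a projection. -/
def projNerve {U V : OpenCovering X} (p : U ⟶ V) : coverNerve V ⟶ coverNerve U where
  app n := TypeCat.ofHom fun s =>
    ⟨fun i => Projection.toFun p (s.1 i), s.2.imp fun _ hx i => Projection.subset p _ (hx i)⟩

/-- The inclusions `⋂ V_i ⊆ ⋂ λ(V_i)` of a projection `λ`. -/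
def projInter {U V : OpenCovering X} (p : U ⟶ V) :
    coverInter V ⟶ elementsMap (projNerve p) ⋙ coverInter U where
  app s := homOfLE (le_iInf fun i =>
    (iInf_le (fun i => (s.2.1 i : Opens X)) i).trans (Projection.subset p _))

/-- The lift of `K(V) ⟶ K(U)` to Čech systems given by the restrictions
`F(⋂ λ(V_i)) ⟶ F(⋂ V_i)`. -/
abbrev projLift {U V : OpenCovering X} (p : U ⟶ V) (F : TopCat.Presheaf AddCommGrpCat.{u} X) :
    (elementsMap (projNerve p)).op ⋙ (cechSystem U).obj F ⟶ (cechSystem V).obj F :=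
  Functor.whiskerRight (NatTrans.op (projInter p)) F

end Covering

/-- The Čech complexes of all coverings, with the maps induced by projections:
`(λ^* c)(V_0, …, V_n) = c(λ V_0, …, λ V_n)` restricted to `V_0 ∩ … ∩ V_n`. -/
@[simps obj]
def cechComplexDiagram (X : TopCat.{u}) : OpenCovering X ⥤
    TopCat.Presheaf AddCommGrpCat.{u} X ⥤ CochainComplex AddCommGrpCat.{u} ℕ where
  obj U := cechComplex U
  map p :=
    { app := fun F => cochainMap (projNerve p) (projLift p F)
      naturality := fun F F' t => by
        refine ((AlgebraicTopology.alternatingCofaceMapComplex _).map_comp _ _).symm.trans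
          (Eq.trans (congrArg _ ?_) ((AlgebraicTopology.alternatingCofaceMapComplex _).map_comp _ _))
        ext n c
        funext v
        exact ConcreteCategory.congr_hom (t.naturality ((projInter p).app _).op).symm _ }
  map_id U := by
    refine NatTrans.ext (funext fun F => ?_)
    refine Eq.trans (congrArg (AlgebraicTopology.alternatingCofaceMapComplex _).map ?_)
      ((AlgebraicTopology.alternatingCofaceMapComplex _).map_id _)
    ext n c
    funext v
    exact ConcreteCategory.congr_hom (F.map_id _) _
  map_comp {U V W} p q := by
    refine NatTrans.ext (funext fun F => ?_)
    refine Eq.trans (congrArg (AlgebraicTopology.alternatingCofaceMapComplex _).map ?_)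
      ((AlgebraicTopology.alternatingCofaceMapComplex _).map_comp _ _)
    ext n c
    funext v
    exact ConcreteCategory.congr_hom (F.map_comp _ _) _

/-- The Čech cohomology groups `H^n(U; F)` of all coverings `U` and presheaves `F`. -/
abbrev cechDiagram (X : TopCat.{u}) (n : ℕ) :
    TopCat.Presheaf AddCommGrpCat.{u} X ⥤ OpenCovering X ⥤ AddCommGrpCat.{u} :=
  (cechComplexDiagram X ⋙ (Functor.whiskeringRight _ _ _).obj
    (HomologicalComplex.homologyFunctor AddCommGrpCat.{u} (ComplexShape.up ℕ) n)).flip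

/-- Čech cohomology `H^n(X; F) = colim_U H^n(U; F)`, functorially in the presheaf `F`. -/
abbrev cechCohomology (X : TopCat.{u}) (n : ℕ) :
    TopCat.Presheaf AddCommGrpCat.{u} X ⥤ AddCommGrpCat.{u} :=
  cechDiagram X n ⋙ Limits.colim

/-- The canonical map `H^n(U; F) ⟶ H^n(X; F)`. -/
abbrev toCechCohomology {X : TopCat.{u}} (U : OpenCovering X)
    (F : TopCat.Presheaf AddCommGrpCat.{u} X) (n : ℕ) :
    ((cechComplex U).obj F).homology n ⟶ (cechCohomology X n).obj F :=
  Limits.colimit.ι ((cechDiagram X n).obj F) U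

/-! ### Posets: the nerve complex, the upper Alexandrov space and the induced sheaf

A poset `A` is regarded as a category with an arrow `α ⟶ β` if and only if `α ≤ β`. -/

section Poset

variable (A : Type u) [PartialOrder A]

/-- Products exist conditionally in `A`: if some `ω` has arrows to both `α` and `α'`, then the
product (i.e. the meet) of `α` and `α'` exists. -/
def HasConditionalProducts : Prop :=
  ∀ α α' ω : A, ω ≤ α → ω ≤ α' → ∃ β : A, IsGLB {α, α'} β

variable {A} in
/-- The vertex `α_i` of a simplex `α_0 ⟶ … ⟶ α_n` of the nerve of `A`. -/
abbrev vertex {n : SimplexCategoryᵒᵖ} (a : (nerve A).obj n) (i : Fin (n.unop.len + 1)) : A :=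
  CategoryTheory.Functor.obj (C := Fin (n.unop.len + 1)) a i

variable {A} in
/-- The first vertex of a simplex has an arrow to every vertex. -/
theorem vertex_zero_le {n : SimplexCategoryᵒᵖ} (a : (nerve A).obj n)
    (i : Fin (n.unop.len + 1)) : vertex a 0 ≤ vertex a i :=
  (CategoryTheory.Functor.map (C := Fin (n.unop.len + 1)) a (homOfLE (Fin.zero_le i))).le

/-- `(α_0 ⟶ … ⟶ α_n) ↦ α_0`, as a functor on the simplices of the nerve of `A`. -/
def nerveFirst : (nerve A).Elements ⥤ A where
  obj a := vertex a.2 0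
  map {a b} f := homOfLE (by
    rw [← f.2]
    exact vertex_zero_le a.2 _)

/-- The lower local system on the nerve of `A`: `G_*(α_0 ⟶ … ⟶ α_n) = G(α_0)`. -/
abbrev lowerSystem : (Aᵒᵖ ⥤ AddCommGrpCat.{u}) ⥤ LocalSystem (nerve A) :=
  (Functor.whiskeringLeft _ _ _).obj (nerveFirst A).op

/-- The nerve complex `C^•(N(A); G_*)`, functorially in the presheaf `G`. -/
abbrev nerveComplex : (Aᵒᵖ ⥤ AddCommGrpCat.{u}) ⥤ CochainComplex AddCommGrpCat.{u} ℕ :=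
  lowerSystem A ⋙ cochainFunctor (nerve A)

/-- The cohomology of the nerve complex, functorially in the presheaf `G`. -/
abbrev nerveCohomology (n : ℕ) : (Aᵒᵖ ⥤ AddCommGrpCat.{u}) ⥤ AddCommGrpCat.{u} :=
  nerveComplex A ⋙ HomologicalComplex.homologyFunctor AddCommGrpCat.{u} (ComplexShape.up ℕ) n

/-- The upper Alexandrov space `X^A`: the set `A` with the topology that has the sets
`U^β = {α | α ⟶ β}` as a basis; its open sets are the sets that contain, with `β`, every `α` with an
arrow `α ⟶ β`. -/
abbrev upperSpace : TopCat.{u} := TopCat.of (Topology.WithLowerSet A)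

variable {A}

/-- The basic open set `U^β = {α | α ⟶ β}`. -/
def basicOpen (β : A) : Opens (upperSpace A) :=
  ⟨{ α | Topology.WithLowerSet.ofLowerSet α ≤ β }, fun _ _ h h' => le_trans h h'⟩

/-- Open sets of `X^A` are closed under passing to the source of an arrow. -/
theorem mem_of_le (U : Opens (upperSpace A)) {α β : A} (h : α ≤ β)
    (hβ : Topology.WithLowerSet.toLowerSet β ∈ U) : Topology.WithLowerSet.toLowerSet α ∈ U :=
  U.isOpen (a := Topology.WithLowerSet.toLowerSet β) (b := Topology.WithLowerSet.toLowerSet α)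
    h hβ

variable (A) in
/-- The canonical covering `U^A = {U^α | α ∈ A}` of `X^A`. -/
def canonicalCovering : OpenCovering (upperSpace A) where
  sets := Set.range (basicOpen (A := A))
  covers x := ⟨basicOpen (Topology.WithLowerSet.ofLowerSet x), ⟨_, rfl⟩, le_refl _⟩

/-- Coherent families `(s_α)_{α ∈ U}`, `s_α ∈ G(α)`, i.e. families such that `s_β` is mapped to
`s_α` for all arrows `α ⟶ β` in `U`. -/
def coherent (G : Aᵒᵖ ⥤ AddCommGrpCat.{u}) (U : Opens (upperSpace A)) :
    AddSubgroup (∀ α : { α : A // Topology.WithLowerSet.toLowerSet α ∈ U }, G.obj (op α.1)) where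
  carrier := { s | ∀ (α β : { α : A // Topology.WithLowerSet.toLowerSet α ∈ U })
    (f : α.1 ⟶ β.1), G.map f.op (s β) = s α }
  zero_mem' := fun α β f => map_zero _
  add_mem' := fun {s t} hs ht α β f => by
    simp only [Pi.add_apply, map_add, hs α β f, ht α β f]
  neg_mem' := fun {s} hs α β f => by simp only [Pi.neg_apply, map_neg, hs α β f]

/-- The presheaf `Ĝ(U) = lim_{α ∈ U} G(α)` on `X^A`. -/
def inducedPresheaf (G : Aᵒᵖ ⥤ AddCommGrpCat.{u}) :
    TopCat.Presheaf AddCommGrpCat.{u} (upperSpace A) where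
  obj U := AddCommGrpCat.of (coherent G U.unop)
  map {U V} i := AddCommGrpCat.ofHom
    { toFun := fun s => ⟨fun α => s.1 ⟨α.1, i.unop.le α.2⟩, fun α β f =>
        s.2 ⟨α.1, i.unop.le α.2⟩ ⟨β.1, i.unop.le β.2⟩ f⟩
      map_zero' := rfl
      map_add' := fun _ _ => rfl }

/-- The morphism `Ĝ ⟶ Ĝ'` induced by `G ⟶ G'`. -/
def inducedPresheafMap {G G' : Aᵒᵖ ⥤ AddCommGrpCat.{u}} (t : G ⟶ G') :
    inducedPresheaf G ⟶ inducedPresheaf G' where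
  app U := AddCommGrpCat.ofHom
    (X := coherent G U.unop) (Y := coherent G' U.unop)
    { toFun := fun s => ⟨fun α => t.app (op α.1) (s.1 α), fun α β f => by
        have h := NatTrans.naturality_apply t f.op (s.1 β)
        rw [s.2 α β f] at h
        exact h.symm⟩
      map_zero' := Subtype.ext (funext fun _ => map_zero _)
      map_add' := fun _ _ => Subtype.ext (funext fun _ => map_add _ _ _) }
  naturality _ _ _ := rfl

/-- `Ĝ` is a sheaf. -/
theorem inducedPresheaf_isSheaf (G : Aᵒᵖ ⥤ AddCommGrpCat.{u}) : (inducedPresheaf G).IsSheaf := by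
  rw [TopCat.Presheaf.isSheaf_iff_isSheafUniqueGluing]
  intro ι U sf hsf
  let σ : ∀ i, coherent G (U i) := sf
  have key : ∀ (i j : ι) (α : A) (hi : Topology.WithLowerSet.toLowerSet α ∈ U i)
      (hj : Topology.WithLowerSet.toLowerSet α ∈ U j),
      (σ i).1 ⟨α, hi⟩ = (σ j).1 ⟨α, hj⟩ :=
    fun i j α hi hj => congrFun (congrArg
      (fun s : coherent G (U i ⊓ U j) => s.1) (hsf i j)) ⟨α, hi, hj⟩
  have ex : ∀ α : { α : A // Topology.WithLowerSet.toLowerSet α ∈ iSup U },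
      ∃ i, Topology.WithLowerSet.toLowerSet α.1 ∈ U i := fun α => Opens.mem_iSup.1 α.2
  choose idx hidx using ex
  refine ⟨(⟨fun α => (σ (idx α)).1 ⟨α.1, hidx α⟩, ?_⟩ :
    coherent G (iSup U)), ?_, ?_⟩
  · intro α β f
    exact ((σ (idx β)).2 ⟨α.1, mem_of_le _ f.le (hidx β)⟩ ⟨β.1, hidx β⟩ f).trans
      (key _ _ _ _ _)
  · intro i
    exact Subtype.ext (funext fun α => key _ _ _ _ _)
  · intro s hs
    refine Subtype.ext (funext fun α => ?_)
    exact congrFun (congrArg (fun s : coherent G (U (idx α)) => s.1) (hs (idx α)))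
      ⟨α.1, hidx α⟩

/-- The sheaf `Ĝ` on `X^A` induced by a presheaf `G` on `A`, functorially in `G`. -/
def inducedSheaf : (Aᵒᵖ ⥤ AddCommGrpCat.{u}) ⥤ TopCat.Sheaf AddCommGrpCat.{u} (upperSpace A) where
  obj G := ⟨inducedPresheaf G, inducedPresheaf_isSheaf G⟩
  map t := ⟨inducedPresheafMap t⟩

/-! ### The comparison map -/

variable (A) in
/-- The simplicial map `j : N(A) ⟶ K(U^A)`,
`(α_0 ⟶ … ⟶ α_n) ↦ (U^{α_0}, …, U^{α_n})`. -/
def compareNerve : nerve A ⟶ coverNerve (canonicalCovering A) where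
  app n := TypeCat.ofHom fun a =>
    ⟨fun i => ⟨basicOpen (A := A) (vertex a i), ⟨_, rfl⟩⟩,
      Topology.WithLowerSet.toLowerSet (vertex (A := A) a 0), fun i => vertex_zero_le (A := A) a i⟩

/-- The first vertex lies in `U^{α_0} ∩ … ∩ U^{α_n}`. -/
theorem vertex_zero_mem {n : SimplexCategoryᵒᵖ} (a : (nerve A).obj n) :
    Topology.WithLowerSet.toLowerSet (vertex a 0) ∈ ⨅ i, basicOpen (A := A) (vertex a i) := by
  rw [← SetLike.mem_coe, Opens.coe_iInf, Set.mem_iInter]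
  exact vertex_zero_le a

/-- The lift of `j` from `G^∨` to `G_*`: the identification
`Ĝ(U^{α_0} ∩ … ∩ U^{α_n}) = Ĝ(U^{α_0}) = G(α_0)`, which takes a coherent family to its component
at `α_0`. -/
def compareLift (G : Aᵒᵖ ⥤ AddCommGrpCat.{u}) :
    (elementsMap (compareNerve A)).op ⋙
      (cechSystem (canonicalCovering A)).obj (inducedSheaf.obj G).obj ⟶ (lowerSystem A).obj G where
  app a := AddCommGrpCat.ofHom
    (X := coherent G (⨅ i, basicOpen (A := A) (vertex a.unop.2 i))) (Y := G.obj (op (vertex a.unop.2 0)))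
    { toFun := fun s => s.1 ⟨vertex a.unop.2 0, vertex_zero_mem a.unop.2⟩
      map_zero' := rfl
      map_add' := fun _ _ => rfl }
  naturality a b f := by
    ext s
    have hs : s.1 ∈ coherent G (⨅ i, basicOpen (A := A) (vertex a.unop.2 i)) := s.2
    have hle : vertex b.unop.2 0 ≤ vertex a.unop.2 0 := ((nerveFirst A).map f.unop).le
    exact (hs ⟨vertex b.unop.2 0, mem_of_le _ hle (vertex_zero_mem a.unop.2)⟩
      ⟨vertex a.unop.2 0, vertex_zero_mem a.unop.2⟩
      ((nerveFirst A).map f.unop)).symm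

/-- The cochain map `j^* : C^•(K(U^A); G^∨) ⟶ C^•(N(A); G_*)`. -/
abbrev compareMap (G : Aᵒᵖ ⥤ AddCommGrpCat.{u}) :
    (cechComplex (canonicalCovering A)).obj (inducedSheaf.obj G).obj ⟶ (nerveComplex A).obj G :=
  cochainMap (compareNerve A) (compareLift G)

/-! ### Topos cohomology -/

instance : AB5OfSize.{u, u} (Aᵒᵖ ⥤ AddCommGrpCat.{u}) where
  ofShape _ := inferInstance

instance : IsGrothendieckAbelian.{u} (Aᵒᵖ ⥤ AddCommGrpCat.{u}) where

variable (A) in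
/-- The topos cohomology `H^n(A, -) = Ext^n(ℤ, -)` of presheaves of abelian groups on `A`: the
derived functors of the global sections functor `Hom(ℤ, -)`, where `ℤ` is the constant presheaf. -/
abbrev toposCohomology (n : ℕ) : (Aᵒᵖ ⥤ AddCommGrpCat.{u}) ⥤ AddCommGrpCat.{u} :=
  Abelian.extFunctorObj ((Functor.const Aᵒᵖ).obj (AddCommGrpCat.of (ULift.{u} ℤ))) n

end Poset

end PosetCech

end

open PosetCech

-- Both cochain complexes are of the form `Hom(P, G)` for chain complexes `P` of presheaves on `A`
-- that do not depend on `G`. Given a simplicial set `K` and a functorial assignment of an open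
-- support `σ s` to every simplex, let `chains σ` be the complex of presheaves whose value at `β` is
-- free on the simplices `s` with `β ∈ σ s`. A morphism from its degree `n` part to `G` is a family
-- of elements of `Ĝ (σ s)`, one for each `n`-simplex (`freeSupportHomEquiv`, `cochainIso`). The
-- supports `U_0 ∩ … ∩ U_n` give the Čech complex, and the supports `U^{α_0}` on the nerve give the
-- nerve complex. The map `j` respects supports, and `j^*` is precomposition with the induced chain
-- map.
--
-- Over a fixed `β`, the simplices of a covering are all sequences of members containing `β`, and
-- those of the nerve are the chains lying above `β`. In both cases a fixed vertex can be put in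
-- front, so both complexes of presheaves are resolutions of the constant presheaf `ℤ`
-- (`quasiIso_augmentation_coverInter`, `quasiIso_augmentation_nerveSupport`). If every support is
-- some `U^β`, the presheaves are sums of representables and hence projective
-- (`projective_freeSupport`). For the nerve this is automatic. For the canonical covering it is
-- what conditional meets provide, since a non-empty intersection of sets `U^{α_i}` is then `U^β`
-- with `β` the meet of the `α_i`. Thus `j` compares two projective resolutions of `ℤ` over the
-- identity, so it is a homotopy equivalence, and so is `j^*`.
--
-- For the direct limit, the canonical covering refines every covering `U`. Any two projections
-- induce homotopic chain maps, because the chains of the canonical covering are projective and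
-- those of `U` form a resolution (`cechDiagram_map_eq`). The limit is therefore attained at the
-- canonical covering. Finally, `Hom` out of the projective resolution given by the nerve computes
-- `Ext^n(ℤ, G)` (`isIso_homologyToExt`).

universe v

noncomputable section

open Limits HomologicalComplex Abelian

/-! ### The contravariant functor `Hom(-, G)` on chain complexes -/

section HomComplex

variable {C : Type u} [Category.{v} C] [Preadditive C]

/-- The cochain complex `Hom(P, G)` of a chain complex `P` and an object `G`. -/
def ChainComplex.homComplex (P : ChainComplex C ℕ) (G : C) : CochainComplex AddCommGrpCat.{v} ℕ where
  X n := AddCommGrpCat.of (P.X n ⟶ G)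
  d i j := AddCommGrpCat.ofHom (Preadditive.leftComp G (P.d j i))
  shape i j hij := by
    rw [P.shape j i hij]
    ext f
    exact zero_comp
  d_comp_d' i j k _ _ := by
    ext f
    change P.d k j ≫ P.d j i ≫ f = 0
    rw [P.d_comp_d_assoc, zero_comp]

/-- The map `Hom(Q, G) ⟶ Hom(P, G)` of precomposition with a chain map `P ⟶ Q`. -/
def ChainComplex.homComplexPrecomp {P Q : ChainComplex C ℕ} (f : P ⟶ Q) (G : C) :
    Q.homComplex G ⟶ P.homComplex G where
  f n := AddCommGrpCat.ofHom (Preadditive.leftComp G (f.f n))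
  comm' i j _ := by
    ext g
    exact (f.comm_assoc j i g).symm

/-- The map `Hom(P, G) ⟶ Hom(P, G')` of postcomposition with a morphism `G ⟶ G'`. -/
def ChainComplex.homComplexPostcomp (P : ChainComplex C ℕ) {G G' : C} (t : G ⟶ G') :
    P.homComplex G ⟶ P.homComplex G' where
  f n := AddCommGrpCat.ofHom (Preadditive.rightComp (P.X n) t)
  comm' i j _ := by
    ext g
    exact (Category.assoc (P.d j i) g t).symm

/-- `Hom(P, -)` as a functor. -/
@[simps]
def ChainComplex.homComplexFunctor (P : ChainComplex C ℕ) :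
    C ⥤ CochainComplex AddCommGrpCat.{v} ℕ where
  obj G := P.homComplex G
  map t := P.homComplexPostcomp t
  map_id G := by
    ext n f
    exact Category.comp_id f
  map_comp s t := by
    ext n f
    exact (Category.assoc f s t).symm

theorem ChainComplex.homComplexPrecomp_id (P : ChainComplex C ℕ) (G : C) :
    homComplexPrecomp (𝟙 P) G = 𝟙 _ := by
  ext n f
  exact Category.id_comp f

theorem ChainComplex.homComplexPrecomp_comp {P Q R : ChainComplex C ℕ} (f : P ⟶ Q) (g : Q ⟶ R)
    (G : C) : homComplexPrecomp (f ≫ g) G = homComplexPrecomp g G ≫ homComplexPrecomp f G := by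
  ext n h
  exact Category.assoc _ _ h

/-- Precomposition with a morphism `P.X j ⟶ Q.X i`. -/
def ChainComplex.homComplexLeftComp {P Q : ChainComplex C ℕ} (G : C) {i j : ℕ} (h : P.X j ⟶ Q.X i) :
    (Q.homComplex G).X i ⟶ (P.homComplex G).X j :=
  AddCommGrpCat.ofHom (Preadditive.leftComp G h)

/-- Homotopic chain maps induce homotopic maps on `Hom(-, G)`. -/
def ChainComplex.homComplexHomotopy {P Q : ChainComplex C ℕ} {f g : P ⟶ Q} (h : Homotopy f g)
    (G : C) : Homotopy (homComplexPrecomp f G) (homComplexPrecomp g G) where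
  hom i j := homComplexLeftComp G (h.hom j i)
  zero i j hij := by
    rw [h.zero j i hij]
    ext f
    exact zero_comp
  comm n := by
    ext k
    have hn := h.comm n
    cases n with
    | zero =>
      rw [Homotopy.prevD_chainComplex, Homotopy.dNext_zero_chainComplex] at hn
      rw [Homotopy.dNext_cochainComplex, Homotopy.prevD_zero_cochainComplex]
      let k' : Q.X 0 ⟶ G := k
      change f.f 0 ≫ k' = h.hom 0 1 ≫ Q.d 1 0 ≫ k' + 0 + g.f 0 ≫ k'
      rw [hn]
      simp
    | succ n =>
      rw [Homotopy.prevD_chainComplex, Homotopy.dNext_succ_chainComplex] at hn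
      rw [Homotopy.dNext_cochainComplex, Homotopy.prevD_succ_cochainComplex]
      let k' : Q.X (n + 1) ⟶ G := k
      change f.f (n + 1) ≫ k' = h.hom (n + 1) (n + 2) ≫ Q.d (n + 2) (n + 1) ≫ k' +
        P.d (n + 1) n ≫ h.hom n (n + 1) ≫ k' + g.f (n + 1) ≫ k'
      rw [hn]
      simp only [Preadditive.add_comp, Category.assoc]
      abel

/-- A homotopy equivalence `P ⟶ Q` induces a homotopy equivalence `Hom(Q, G) ⟶ Hom(P, G)`. -/
def ChainComplex.homComplexHomotopyEquiv {P Q : ChainComplex C ℕ} (e : HomotopyEquiv P Q) (G : C) :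
    HomotopyEquiv (Q.homComplex G) (P.homComplex G) where
  hom := homComplexPrecomp e.hom G
  inv := homComplexPrecomp e.inv G
  homotopyHomInvId := (Homotopy.ofEq (homComplexPrecomp_comp _ _ G).symm).trans
    ((homComplexHomotopy e.homotopyInvHomId G).trans (Homotopy.ofEq (homComplexPrecomp_id Q G)))
  homotopyInvHomId := (Homotopy.ofEq (homComplexPrecomp_comp _ _ G).symm).trans
    ((homComplexHomotopy e.homotopyHomInvId G).trans (Homotopy.ofEq (homComplexPrecomp_id P G)))

end HomComplex

/-! ### Comparing complexes of projectives with resolutions -/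

section Lifting

variable {C : Type u} [Category.{v} C] [Abelian C]

/-- The cokernel of `d 1 0` is `H_0(Q)`, which the quasi-isomorphism identifies with `Z` through
`π.f 0`. So `π.f 0` is itself a cokernel of `d 1 0`. -/
theorem ChainComplex.exact_augmentation {Q : ChainComplex C ℕ} {Z : C}
    (π : Q ⟶ (ChainComplex.single₀ C).obj Z) [QuasiIso π] (w : Q.d 1 0 ≫ π.f 0 = 0) :
    (ShortComplex.mk (Q.d 1 0) (π.f 0) w).Exact := by
  let S := (ChainComplex.single₀ C).obj Z
  have : IsIso (S.pOpcycles 0) := S.isIso_pOpcycles 1 0 (by simp) (single_obj_d _ _ _ _ _)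
  let e : Q.opcycles 0 ≅ S.X 0 := Q.isoHomologyι₀.symm ≪≫ isoOfQuasiIsoAt π 0 ≪≫
    S.isoHomologyι₀ ≪≫ (asIso (S.pOpcycles 0)).symm
  have he : Q.pOpcycles 0 ≫ e.hom = π.f 0 := by
    simp only [e, Iso.trans_hom, Iso.symm_hom, isoOfQuasiIsoAt_hom, S,
      ChainComplex.isoHomologyι₀_inv_naturality_assoc, p_opcyclesMap_assoc, Iso.inv_hom_id_assoc]
    exact (congrArg (π.f 0 ≫ ·) (asIso (S.pOpcycles 0)).hom_inv_id).trans (Category.comp_id _)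
  exact ShortComplex.exact_of_g_is_cokernel _ (IsColimit.ofIsoColimit
    (Q.opcyclesIsCokernel 1 0 (by simp)) (Cofork.ext e he))

theorem ChainComplex.exact_of_quasiIso_single₀ {Q : ChainComplex C ℕ} {Z : C}
    (π : Q ⟶ (ChainComplex.single₀ C).obj Z) [QuasiIso π] (n : ℕ) :
    (ShortComplex.mk _ _ (Q.d_comp_d (n + 2) (n + 1) n)).Exact := by
  refine ((HomologicalComplex.exactAt_iff' _ (n + 2) (n + 1) n) (by simp only [ChainComplex.prev]; rfl)
    (by simp)).1 ?_
  rw [← quasiIsoAt_iff_exactAt' π (n + 1) (ChainComplex.exactAt_succ_single_obj _ _)]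
  infer_instance

/-- A chain map from a complex of projectives to a resolution is null-homotopic if its composition
with the augmentation vanishes. -/
theorem ChainComplex.nonempty_homotopy_zero_of_projective {P Q : ChainComplex C ℕ}
    [∀ n, Projective (P.X n)] {Z : C} (π : Q ⟶ (ChainComplex.single₀ C).obj Z) [QuasiIso π]
    (f : P ⟶ Q) (hf : f ≫ π = 0) : Nonempty (Homotopy f 0) := by
  have w : Q.d 1 0 ≫ π.f 0 = 0 := by rw [← π.comm 1 0, single_obj_d, comp_zero]
  have e₀ := exact_augmentation π w
  have e := exact_of_quasiIso_single₀ π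
  -- Only exactness of `Q` and projectivity of `P` are used; `Q` need not be projective. This
  -- matters later for arbitrary coverings.
  let h₀ := e₀.liftFromProjective (f.f 0) (HomologicalComplex.congr_hom hf 0)
  have hh₀ : h₀ ≫ Q.d 1 0 = f.f 0 := e₀.liftFromProjective_comp _ _
  have w₁ : (f.f 1 - P.d 1 0 ≫ h₀) ≫ Q.d 1 0 = 0 := by
    rw [Preadditive.sub_comp, Category.assoc, f.comm, hh₀, sub_self]
  let h₁ := (e 0).liftFromProjective (f.f 1 - P.d 1 0 ≫ h₀) w₁
  have hh₁ : h₁ ≫ Q.d 2 1 = f.f 1 - P.d 1 0 ≫ h₀ := (e 0).liftFromProjective_comp _ w₁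
  refine ⟨Homotopy.mkInductive f h₀ hh₀.symm h₁ (by rw [hh₁]; abel) fun n ⟨g, g', wg⟩ => ?_⟩
  -- The part of `f` not yet accounted for by the homotopy lands in cycles, so it lifts through the
  -- next differential of `Q`.
  have w₂ : (f.f (n + 2) - P.d (n + 2) (n + 1) ≫ g') ≫ Q.d (n + 2) (n + 1) = 0 := by simp [wg]
  refine ⟨(e (n + 1)).liftFromProjective _ w₂, ?_⟩
  rw [(e (n + 1)).liftFromProjective_comp _ w₂]
  abel

/-- Two chain maps from a complex of projectives to a resolution are homotopic if they agree after
composition with the augmentation. -/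
theorem ChainComplex.nonempty_homotopy_of_projective {P Q : ChainComplex C ℕ}
    [∀ n, Projective (P.X n)] {Z : C} (π : Q ⟶ (ChainComplex.single₀ C).obj Z) [QuasiIso π]
    (f g : P ⟶ Q) (hfg : f ≫ π = g ≫ π) : Nonempty (Homotopy f g) :=
  (nonempty_homotopy_zero_of_projective π (f - g) (by simp [hfg])).map
    Homotopy.equivSubZero.invFun

/-- A chain map between projective resolutions of the same object that is compatible with the
augmentations is a homotopy equivalence. -/
theorem CategoryTheory.ProjectiveResolution.exists_homotopyEquiv_hom_eq {Z : C}
    (P Q : ProjectiveResolution Z) (f : P.complex ⟶ Q.complex) (hf : f ≫ Q.π = P.π) :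
    ∃ e : HomotopyEquiv P.complex Q.complex, e.hom = f :=
  ⟨{ hom := f
     inv := ProjectiveResolution.lift (𝟙 Z) Q P
     homotopyHomInvId := ProjectiveResolution.liftHomotopy (𝟙 Z) _ _ (by simp [hf]) (by simp)
     homotopyInvHomId := ProjectiveResolution.liftHomotopy (𝟙 Z) _ _ (by simp [hf]) (by simp) },
    rfl⟩

end Lifting

/-! ### Quasi-isomorphisms of complexes of functors -/

section Evaluation

variable {J : Type*} [Category* J] {D : Type*} [Category* D] [Abelian D]

/-- Evaluation at an object is exact, so it commutes with homology, and isomorphisms of functors are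
detected objectwise. -/
theorem HomologicalComplex.quasiIso_of_evaluation {ι : Type*} {c : ComplexShape ι}
    {K L : HomologicalComplex (J ⥤ D) c} (f : K ⟶ L)
    (h : ∀ j, QuasiIso ((((evaluation J D).obj j).mapHomologicalComplex c).map f)) :
    QuasiIso f where
  quasiIsoAt i := by
    rw [quasiIsoAt_iff_isIso_homologyMap, NatTrans.isIso_iff_isIso_app]
    intro j
    have := (h j).quasiIsoAt i
    rw [quasiIsoAt_iff_isIso_homologyMap] at this
    have key := ShortComplex.mapHomologyIso_hom_naturality
      ((shortComplexFunctor (J ⥤ D) c i).map f) ((evaluation J D).obj j)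
    have h2 : IsIso (((evaluation J D).obj j).map
      (ShortComplex.homologyMap ((shortComplexFunctor (J ⥤ D) c i).map f))) := by
      rw [← Iso.inv_comp_eq] at key
      rw [← key]
      have : IsIso (ShortComplex.homologyMap (((evaluation J D).obj j).mapShortComplex.map
        ((shortComplexFunctor (J ⥤ D) c i).map f))) := this
      exact IsIso.comp_isIso' inferInstance (IsIso.comp_isIso' this inferInstance)
    exact h2

end Evaluation

/-! ### `Ext` as the cohomology of `Hom(R, Y)` for a projective resolution `R` -/

section Ext

variable {C : Type u} [Category.{v} C] [Abelian C] {Z : C}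

namespace CategoryTheory.ProjectiveResolution

variable (R : ProjectiveResolution Z)

/-- The morphism underlying a cocycle of `Hom(R, Y)`. -/
def cycleHom {Y : C} {n : ℕ} (z : (R.complex.homComplex Y).cycles n) : R.complex.X n ⟶ Y :=
  (R.complex.homComplex Y).iCycles n z

theorem d_comp_cycleHom {Y : C} {n : ℕ} (z : (R.complex.homComplex Y).cycles n) :
    R.complex.d (n + 1) n ≫ R.cycleHom z = 0 :=
  ConcreteCategory.congr_hom ((R.complex.homComplex Y).iCycles_d n (n + 1)) z

theorem cycleHom_injective {Y : C} {n : ℕ} :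
    Function.Injective (R.cycleHom (Y := Y) (n := n)) :=
  (AddCommGrpCat.mono_iff_injective ((R.complex.homComplex Y).iCycles n)).1 inferInstance

theorem exists_cycleHom_eq {Y : C} {n : ℕ} (f : R.complex.X n ⟶ Y)
    (hf : R.complex.d (n + 1) n ≫ f = 0) : ∃ z, R.cycleHom (n := n) z = f :=
  (ShortComplex.ab_exact_iff _).1 (ShortComplex.exact_of_f_is_kernel (ShortComplex.mk _ _
    ((R.complex.homComplex Y).iCycles_d n (n + 1)))
    ((R.complex.homComplex Y).cyclesIsKernel n (n + 1) (by simp))) f hf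

variable [HasExt.{v} C]

/-- In degree `0` there are no coboundaries. A coboundary would factor through the degree `1` term
of the resolution in cohomological grading, which is zero. -/
theorem extMk_zero_eq_zero_iff {Y : C} (f : R.complex.X 0 ⟶ Y) (hf : R.complex.d 1 0 ≫ f = 0) :
    R.extMk f 1 rfl hf = 0 ↔ f = 0 := by
  refine ⟨fun h => ?_, fun h => by subst h; simp⟩
  rw [← R.extEquivCohomologyClass.apply_eq_iff_eq,
    extEquivCohomologyClass_extMk, extEquivCohomologyClass_zero,
    CochainComplex.HomComplex.CohomologyClass.mk_eq_zero_iff,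
    CochainComplex.HomComplex.Cocycle.toSingleMk_mem_coboundaries_iff _ _ _ _ _ 1 (by lia)] at h
  obtain ⟨g, hg⟩ := h
  rw [(CochainComplex.isZero_of_isStrictlyLE R.cochainComplex 0 1).eq_of_src g 0, comp_zero] at hg
  rw [← cancel_epi (R.cochainComplexXIso (-(0 : ℕ)) 0 rfl).hom, ← hg, comp_zero]

/-- The class in `Ext Z Y n` of a cocycle of `Hom(R, Y)`. -/
def cyclesToExt (Y : C) (n : ℕ) :
    (R.complex.homComplex Y).cycles n ⟶ (extFunctorObj Z n).obj Y :=
  AddCommGrpCat.ofHom (AddMonoidHom.mk' (fun z => R.extMk (R.cycleHom z) (n + 1) rfl (R.d_comp_cycleHom z))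
    fun z z' => by
      rw [add_extMk]
      congr 1
      exact map_add ((R.complex.homComplex Y).iCycles n).hom z z')

theorem toCycles_cyclesToExt (Y : C) (m n : ℕ) :
    (R.complex.homComplex Y).toCycles m n ≫ R.cyclesToExt Y n = 0 := by
  -- The second case is needed in degree `0`, where the index preceding `0` defaults to `0` and the
  -- map into the cycles vanishes.
  by_cases h : m + 1 = n
  · ext g
    refine (R.extMk_eq_zero_iff _ (n + 1) rfl (R.d_comp_cycleHom _) m h).2 ⟨g, ?_⟩
    exact (ConcreteCategory.congr_hom ((R.complex.homComplex Y).toCycles_i m n) g).symm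
  · rw [(R.complex.homComplex Y).toCycles_eq_zero (i := m) h, zero_comp]

/-- The comparison map from the cohomology of `Hom(R, Y)` to `Ext Z Y n`. -/
def homologyToExt (Y : C) (n : ℕ) :
    (R.complex.homComplex Y).homology n ⟶ (extFunctorObj Z n).obj Y :=
  ((R.complex.homComplex Y).homologyIsCokernel _ n rfl).desc
    (CokernelCofork.ofπ (R.cyclesToExt Y n) (R.toCycles_cyclesToExt Y _ n))

theorem homologyπ_homologyToExt (Y : C) (n : ℕ) :
    (R.complex.homComplex Y).homologyπ n ≫ R.homologyToExt Y n = R.cyclesToExt Y n :=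
  ((R.complex.homComplex Y).homologyIsCokernel _ n rfl).fac _ WalkingParallelPair.one

/-- Every `Ext` class is represented by a cocycle, which gives surjectivity. A cocycle has zero
class only if it factors through the preceding differential (or is zero, in degree `0`), which gives
injectivity. -/
theorem isIso_homologyToExt (Y : C) (n : ℕ) : IsIso (R.homologyToExt Y n) := by
  have hepi : Function.Surjective ((R.complex.homComplex Y).homologyπ n) :=
    (AddCommGrpCat.epi_iff_surjective _).1 inferInstance
  have hcomp (z) : R.homologyToExt Y n ((R.complex.homComplex Y).homologyπ n z) =
      R.cyclesToExt Y n z := ConcreteCategory.congr_hom (R.homologyπ_homologyToExt Y n) z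
  refine (ConcreteCategory.isIso_iff_bijective _).2 ⟨?_, fun x => ?_⟩
  · refine (injective_iff_map_eq_zero (R.homologyToExt Y n).hom).2 fun x hx => ?_
    obtain ⟨z, rfl⟩ := hepi x
    replace hx : R.extMk (R.cycleHom z) (n + 1) rfl (R.d_comp_cycleHom z) = 0 := (hcomp z).symm.trans hx
    cases n with
    | zero =>
      rw [extMk_zero_eq_zero_iff] at hx
      have : z = 0 := R.cycleHom_injective (hx.trans (map_zero _).symm)
      rw [this, map_zero]
    | succ n =>
      obtain ⟨g, hg⟩ := (R.extMk_eq_zero_iff _ _ _ _ n rfl).1 hx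
      have : (R.complex.homComplex Y).toCycles n (n + 1) g = z :=
        R.cycleHom_injective ((ConcreteCategory.congr_hom
          ((R.complex.homComplex Y).toCycles_i n (n + 1)) g).trans hg)
      rw [← this]
      exact ConcreteCategory.congr_hom
        ((R.complex.homComplex Y).toCycles_comp_homologyπ n (n + 1)) g
  · obtain ⟨f, hf, rfl⟩ := R.extMk_surjective x (n + 1) rfl
    obtain ⟨z, rfl⟩ := R.exists_cycleHom_eq f hf
    exact ⟨_, hcomp z⟩

/-- Natural in `Y`, the cohomology of `Hom(R, Y)` is `Ext Z Y n`. -/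
def homologyIsoExt (n : ℕ) :
    R.complex.homComplexFunctor ⋙ homologyFunctor AddCommGrpCat.{v} (ComplexShape.up ℕ) n ≅
      extFunctorObj Z n :=
  NatIso.ofComponents (fun Y => @asIso _ _ _ _ _ (R.isIso_homologyToExt Y n)) fun {Y Y'} t => by
    change homologyMap (R.complex.homComplexPostcomp t) n ≫ R.homologyToExt Y' n =
      R.homologyToExt Y n ≫ (extFunctorObj Z n).map t
    rw [← cancel_epi ((R.complex.homComplex Y).homologyπ n), homologyπ_naturality_assoc,
      homologyπ_homologyToExt, reassoc_of% homologyπ_homologyToExt]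
    ext z
    refine Eq.trans ?_ (R.extMk_comp_mk₀ _ (n + 1) rfl (R.d_comp_cycleHom z) t).symm
    change R.extMk (R.cycleHom _) (n + 1) rfl (R.d_comp_cycleHom _) = _
    congr 1
    exact ConcreteCategory.congr_hom (cyclesMap_i (R.complex.homComplexPostcomp t) n) z

end CategoryTheory.ProjectiveResolution
end Ext

/-! ### Free presheaves on simplices with supports, and cochains as morphisms out of them -/

namespace PosetCech

theorem alternatingCofaceMapComplex_obj_d {C : Type*} [Category* C] [Preadditive C]
    (X : CosimplicialObject C) (n : ℕ) :
    ((AlgebraicTopology.alternatingCofaceMapComplex C).obj X).d n (n + 1) =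
      ∑ i : Fin (n + 2), (-1 : ℤ) ^ (i : ℕ) • X.δ i :=
  CochainComplex.of_d (fun n => X.obj (SimplexCategory.mk n))
    (AlgebraicTopology.AlternatingCofaceMapComplex.objD X) n

section Chains

variable {A : Type u} [PartialOrder A] {K L : SSet.{u}}

/-- The simplicial presheaf on `A` whose `n`-simplices over `β` are the `n`-simplices `s` of `K`
with `β ∈ σ s`. -/
def supportPresheaf (σ : K.Elements ⥤ Opens (upperSpace A)) : SimplicialObject (Aᵒᵖ ⥤ Type u) where
  obj n :=
    { obj := fun β => { s : K.obj n //
        Topology.WithLowerSet.toLowerSet β.unop ∈ σ.obj (K.elementsMk n s) }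
      map := fun f => TypeCat.ofHom fun s => ⟨s.1, mem_of_le _ f.unop.le s.2⟩ }
  map {n m} φ :=
    { app := fun β => TypeCat.ofHom fun s => ⟨K.map φ s.1, (σ.map (CategoryOfElements.homMk
        (K.elementsMk n s.1) (K.elementsMk m (K.map φ s.1)) φ rfl)).le s.2⟩ }
  map_id n := by
    refine NatTrans.ext (funext fun β => ?_)
    ext ⟨s, hs⟩
    exact ConcreteCategory.congr_hom (K.map_id n) s
  map_comp φ ψ := by
    refine NatTrans.ext (funext fun β => ?_)
    ext ⟨s, hs⟩
    exact ConcreteCategory.congr_hom (K.map_comp φ ψ) s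

/-- The map of simplicial presheaves induced by a simplicial map that enlarges supports. -/
def supportPresheafMap (f : K ⟶ L) {σ : K.Elements ⥤ Opens (upperSpace A)}
    {τ : L.Elements ⥤ Opens (upperSpace A)} (i : σ ⟶ elementsMap f ⋙ τ) :
    supportPresheaf σ ⟶ supportPresheaf τ where
  app n :=
    { app := fun β => TypeCat.ofHom fun s => ⟨f.app n s.1, (i.app (K.elementsMk n s.1)).le s.2⟩ }
  naturality n m φ := by
    refine NatTrans.ext (funext fun β => ?_)
    ext ⟨s, hs⟩
    refine Subtype.ext ?_
    exact ConcreteCategory.congr_hom (f.naturality φ) s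

/-- The simplicial presheaf of free abelian groups on `supportPresheaf σ`. -/
abbrev freeSupport (σ : K.Elements ⥤ Opens (upperSpace A)) :
    SimplicialObject (Aᵒᵖ ⥤ AddCommGrpCat.{u}) :=
  ((SimplicialObject.whiskering _ _).obj ((Functor.whiskeringRight _ _ _).obj
    AddCommGrpCat.free)).obj (supportPresheaf σ)

/-- The chain complex of presheaves of `freeSupport σ`. -/
abbrev chains (σ : K.Elements ⥤ Opens (upperSpace A)) :
    ChainComplex (Aᵒᵖ ⥤ AddCommGrpCat.{u}) ℕ :=
  (AlgebraicTopology.alternatingFaceMapComplex _).obj (freeSupport σ)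

/-- The chain map induced by a simplicial map that enlarges supports. -/
abbrev chainsMap (f : K ⟶ L) {σ : K.Elements ⥤ Opens (upperSpace A)}
    {τ : L.Elements ⥤ Opens (upperSpace A)} (i : σ ⟶ elementsMap f ⋙ τ) : chains σ ⟶ chains τ :=
  (AlgebraicTopology.alternatingFaceMapComplex _).map
    (((SimplicialObject.whiskering _ _).obj ((Functor.whiskeringRight _ _ _).obj
      AddCommGrpCat.free)).map (supportPresheafMap f i))

/-- The generator of `freeSupport σ` given by a simplex `s` with `β ∈ σ s`. -/
def generator (σ : K.Elements ⥤ Opens (upperSpace A)) {n : SimplexCategoryᵒᵖ} (s : K.obj n) (β : A)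
    (h : Topology.WithLowerSet.toLowerSet β ∈ σ.obj (K.elementsMk n s)) :
    ((freeSupport σ).obj n).obj (op β) :=
  FreeAbelianGroup.of (⟨s, h⟩ : ((supportPresheaf σ).obj n).obj (op β))

theorem freeSupport_map_generator (σ : K.Elements ⥤ Opens (upperSpace A)) {n : SimplexCategoryᵒᵖ}
    (s : K.obj n) {β γ : A} (h : Topology.WithLowerSet.toLowerSet β ∈ σ.obj (K.elementsMk n s))
    (f : γ ⟶ β) : ((freeSupport σ).obj n).map f.op (generator σ s β h) =
      generator σ s γ (mem_of_le _ f.le h) :=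
  FreeAbelianGroup.map_of_apply _

theorem freeSupport_hom_ext {σ : K.Elements ⥤ Opens (upperSpace A)} {n : SimplexCategoryᵒᵖ}
    {G : Aᵒᵖ ⥤ AddCommGrpCat.{u}} {f g : (freeSupport σ).obj n ⟶ G}
    (h : ∀ s β hs, f.app (op β) (generator σ s β hs) = g.app (op β) (generator σ s β hs)) :
    f = g := by
  refine NatTrans.ext (funext fun β => AddCommGrpCat.hom_ext (FreeAbelianGroup.lift_ext _ _ ?_))
  rintro ⟨s, hs⟩
  exact h s β.unop hs

/-- The morphism from `freeSupport σ` to `G` given by a family of sections of `Ĝ`. -/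
def freeSupportHom {σ : K.Elements ⥤ Opens (upperSpace A)} {G : Aᵒᵖ ⥤ AddCommGrpCat.{u}}
    {n : SimplexCategoryᵒᵖ} (c : ∀ s : K.obj n, coherent G (σ.obj (K.elementsMk n s))) :
    (freeSupport σ).obj n ⟶ G where
  app β := AddCommGrpCat.ofHom (FreeAbelianGroup.lift
    fun s : ((supportPresheaf σ).obj n).obj β => (c s.1).1 ⟨β.unop, s.2⟩)
  naturality β γ f := by
    refine AddCommGrpCat.hom_ext (FreeAbelianGroup.lift_ext _ _ ?_)
    rintro ⟨s, hs⟩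
    change FreeAbelianGroup.lift _ (((freeSupport σ).obj n).map f (generator σ s β.unop hs)) =
      G.map f (FreeAbelianGroup.lift _ (FreeAbelianGroup.of _))
    refine (congrArg _ (freeSupport_map_generator σ s hs f.unop)).trans ?_
    refine (FreeAbelianGroup.lift_apply_of _ _).trans ?_
    refine Eq.trans ?_ (congrArg (G.map f) (FreeAbelianGroup.lift_apply_of _ _)).symm
    exact ((c s).2 ⟨γ.unop, mem_of_le _ f.unop.le hs⟩ ⟨β.unop, hs⟩ f.unop).symm

theorem freeSupportHom_app_generator {σ : K.Elements ⥤ Opens (upperSpace A)}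
    {G : Aᵒᵖ ⥤ AddCommGrpCat.{u}} {n : SimplexCategoryᵒᵖ}
    (c : ∀ s : K.obj n, coherent G (σ.obj (K.elementsMk n s))) (s : K.obj n) (β : A) (hs) :
    (freeSupportHom c).app (op β) (generator σ s β hs) = (c s).1 ⟨β, hs⟩ :=
  FreeAbelianGroup.lift_apply_of _ _

/-- Morphisms from `freeSupport σ` to `G` are families of sections of `Ĝ` over the supports of the
simplices. -/
def freeSupportHomEquiv (σ : K.Elements ⥤ Opens (upperSpace A)) (G : Aᵒᵖ ⥤ AddCommGrpCat.{u})
    (n : SimplexCategoryᵒᵖ) :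
    (∀ s : K.obj n, coherent G (σ.obj (K.elementsMk n s))) ≃+ ((freeSupport σ).obj n ⟶ G) where
  toFun c := freeSupportHom c
  invFun f s := ⟨fun α => f.app (op α.1) (generator σ s α.1 α.2), fun α β g => by
    rw [← NatTrans.naturality_apply f g.op, freeSupport_map_generator]⟩
  left_inv c := by
    funext s
    exact Subtype.ext (funext fun α => freeSupportHom_app_generator c s α.1 α.2)
  right_inv f := freeSupport_hom_ext fun s β hs => freeSupportHom_app_generator _ s β hs
  map_add' c c' := freeSupport_hom_ext fun s β hs => by
    refine (freeSupportHom_app_generator _ s β hs).trans ?_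
    change (c s).1 ⟨β, hs⟩ + (c' s).1 ⟨β, hs⟩ = (freeSupportHom c).app (op β) (generator σ s β hs) +
      (freeSupportHom c').app (op β) (generator σ s β hs)
    rw [freeSupportHom_app_generator, freeSupportHom_app_generator]

theorem freeSupportHomEquiv_app_generator (σ : K.Elements ⥤ Opens (upperSpace A))
    (G : Aᵒᵖ ⥤ AddCommGrpCat.{u}) (n : SimplexCategoryᵒᵖ)
    (c : ∀ s : K.obj n, coherent G (σ.obj (K.elementsMk n s))) (s : K.obj n) (β : A) (hs) :
    (freeSupportHomEquiv σ G n c).app (op β) (generator σ s β hs) = (c s).1 ⟨β, hs⟩ :=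
  freeSupportHom_app_generator c s β hs

theorem freeSupport_simplicial_map_generator (σ : K.Elements ⥤ Opens (upperSpace A))
    {n m : SimplexCategoryᵒᵖ} (φ : n ⟶ m) (s : K.obj n) (β : A) (hs) :
    ((freeSupport σ).map φ).app (op β) (generator σ s β hs) =
      generator σ (K.map φ s) β ((σ.map (CategoryOfElements.homMk
        (K.elementsMk n s) (K.elementsMk m (K.map φ s)) φ rfl)).le hs) :=
  FreeAbelianGroup.map_of_apply _

theorem chainsMap_f_app_generator (f : K ⟶ L) {σ : K.Elements ⥤ Opens (upperSpace A)}
    {τ : L.Elements ⥤ Opens (upperSpace A)} (i : σ ⟶ elementsMap f ⋙ τ) (n : ℕ)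
    (s : K.obj (op (SimplexCategory.mk n))) (β : A) (hs) :
    ((chainsMap f i).f n).app (op β) (generator σ s β hs) =
      generator τ (f.app _ s) β ((i.app (K.elementsMk _ s)).le hs) :=
  FreeAbelianGroup.map_of_apply _

/-- On a generator `s` over `β`, both sides are the component at `β` of the section attached to `φ^*
s`. Applied to the coface maps, this matches the two alternating-sum differentials. -/
theorem freeSupport_map_comp_homEquiv (σ : K.Elements ⥤ Opens (upperSpace A))
    (G : Aᵒᵖ ⥤ AddCommGrpCat.{u}) {n m : SimplexCategory} (φ : n ⟶ m)
    (c : ∀ s : K.obj (op n), coherent G (σ.obj (K.elementsMk (op n) s))) :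
    (freeSupport σ).map φ.op ≫ freeSupportHomEquiv σ G (op n) c = freeSupportHomEquiv σ G (op m)
      ((LocalSystem.cosimplicial (σ.op ⋙ inducedPresheaf G)).map φ c) := by
  refine freeSupport_hom_ext fun s β hs => ?_
  refine Eq.trans ?_ (freeSupportHomEquiv_app_generator σ G _ _ s β hs).symm
  refine (congrArg ((freeSupportHomEquiv σ G (op n) c).app (op β))
    (freeSupport_simplicial_map_generator σ φ.op s β hs)).trans ?_
  exact freeSupportHomEquiv_app_generator σ G _ c _ β _

/-- The cochain complex of `K` with coefficients in `Ĝ ∘ σ` is `Hom(chains σ, G)`. -/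
def cochainIso (σ : K.Elements ⥤ Opens (upperSpace A)) (G : Aᵒᵖ ⥤ AddCommGrpCat.{u}) :
    (cochainFunctor K).obj (σ.op ⋙ inducedPresheaf G) ≅ (chains σ).homComplex G :=
  HomologicalComplex.Hom.isoOfComponents
    (fun n => (freeSupportHomEquiv σ G (op (SimplexCategory.mk n))).toAddCommGrpIso)
    (by
      rintro n _ rfl
      ext c
      let c' : ∀ s : K.obj (op (SimplexCategory.mk n)), coherent G (σ.obj (K.elementsMk _ s)) := c
      change (chains σ).d (n + 1) n ≫ freeSupportHomEquiv σ G (op (SimplexCategory.mk n)) c' =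
        freeSupportHomEquiv σ G (op (SimplexCategory.mk (n + 1)))
          (((cochainFunctor K).obj (σ.op ⋙ inducedPresheaf G)).d n (n + 1) c')
      have hd : ((cochainFunctor K).obj (σ.op ⋙ inducedPresheaf G)).d n (n + 1) =
          ∑ i : Fin (n + 2), (-1 : ℤ) ^ (i : ℕ) • (LocalSystem.cosimplicial
            (σ.op ⋙ inducedPresheaf G)).δ i :=
        alternatingCofaceMapComplex_obj_d _ n
      have hd' : ((cochainFunctor K).obj (σ.op ⋙ inducedPresheaf G)).d n (n + 1) c' =
          ∑ i : Fin (n + 2), (-1 : ℤ) ^ (i : ℕ) • (LocalSystem.cosimplicial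
            (σ.op ⋙ inducedPresheaf G)).δ i c' := by
        rw [hd]
        -- Evaluation at `c'` is additive in the morphism, so it passes through the alternating sum.
        let ev : ((LocalSystem.cosimplicial (σ.op ⋙ inducedPresheaf G)).obj (SimplexCategory.mk n) ⟶
            (LocalSystem.cosimplicial (σ.op ⋙ inducedPresheaf G)).obj
              (SimplexCategory.mk (n + 1))) →+
            (LocalSystem.cosimplicial (σ.op ⋙ inducedPresheaf G)).obj
              (SimplexCategory.mk (n + 1)) :=
          AddMonoidHom.mk' (fun f => f c') fun _ _ => rfl
        exact (map_sum ev _ _).trans (Finset.sum_congr rfl fun i _ => map_zsmul ev _ _)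
      rw [AlgebraicTopology.alternatingFaceMapComplex_obj_d, hd']
      refine Eq.trans ?_ (map_sum (freeSupportHomEquiv σ G _) _ _).symm
      rw [AlgebraicTopology.AlternatingFaceMapComplex.objD, Preadditive.sum_comp]
      refine Finset.sum_congr rfl fun i _ => ?_
      refine Eq.trans ?_ (map_zsmul (freeSupportHomEquiv σ G _) _ _).symm
      rw [Preadditive.zsmul_comp]
      exact congrArg _ (freeSupport_map_comp_homEquiv σ G _ c'))

theorem cochainIso_hom_f_app_generator (σ : K.Elements ⥤ Opens (upperSpace A))
    (G : Aᵒᵖ ⥤ AddCommGrpCat.{u}) (n : ℕ)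
    (c : ∀ s : K.obj (op (SimplexCategory.mk n)), coherent G (σ.obj (K.elementsMk _ s)))
    (s : K.obj (op (SimplexCategory.mk n))) (β : A) (hs) :
    (show (freeSupport σ).obj (op (SimplexCategory.mk n)) ⟶ G from
      (cochainIso σ G).hom.f n c).app (op β) (generator σ s β hs) = (c s).1 ⟨β, hs⟩ :=
  freeSupportHomEquiv_app_generator σ G _ c s β hs

/-- This turns statements about `j^*` and about projections between coverings into statements about
chain maps of presheaves that do not involve `G`. -/
theorem cochainMap_comp_cochainIso_hom (f : K ⟶ L) {σ : K.Elements ⥤ Opens (upperSpace A)}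
    {τ : L.Elements ⥤ Opens (upperSpace A)} (i : σ ⟶ elementsMap f ⋙ τ)
    (G : Aᵒᵖ ⥤ AddCommGrpCat.{u}) :
    cochainMap f (G := τ.op ⋙ inducedPresheaf G) (F := σ.op ⋙ inducedPresheaf G)
        (Functor.whiskerRight (NatTrans.op i) (inducedPresheaf G)) ≫ (cochainIso σ G).hom =
      (cochainIso τ G).hom ≫ ChainComplex.homComplexPrecomp (chainsMap f i) G := by
  ext n c
  refine freeSupport_hom_ext fun s β hs => ?_
  refine (cochainIso_hom_f_app_generator σ G n _ s β hs).trans ?_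
  refine Eq.trans ?_ (congrArg ((show (freeSupport τ).obj (op (SimplexCategory.mk n)) ⟶ G from
    (cochainIso τ G).hom.f n c).app (op β)) (chainsMap_f_app_generator f i n s β hs)).symm
  exact (cochainIso_hom_f_app_generator τ G n c _ β _).symm

theorem cochainIso_hom_naturality (σ : K.Elements ⥤ Opens (upperSpace A))
    {G G' : Aᵒᵖ ⥤ AddCommGrpCat.{u}} (t : G ⟶ G') :
    (cochainFunctor K).map (Functor.whiskerLeft σ.op (inducedPresheafMap t)) ≫
        (cochainIso σ G').hom =
      (cochainIso σ G).hom ≫ (chains σ).homComplexPostcomp t := by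
  ext n c
  refine freeSupport_hom_ext fun s β hs => ?_
  refine (cochainIso_hom_f_app_generator σ G' n _ s β hs).trans ?_
  exact (congrArg (t.app (op β)) (cochainIso_hom_f_app_generator σ G n c s β hs)).symm

end Chains

end PosetCech

/-! ### Extra degeneracies and acyclicity -/

/-- An augmented simplicial set over a point has an extra degeneracy if its simplices are determined
by their vertices and a fixed vertex can be put in front of every simplex. -/
theorem CategoryTheory.SimplicialObject.Augmented.nonempty_extraDegeneracy_of_cons
    (X : SimplicialObject.Augmented (Type u)) [Subsingleton X.right] {E : Type*}
    (vert : ∀ n : ℕ, X.left.obj (op (SimplexCategory.mk n)) → Fin (n + 1) → E)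
    (inj : ∀ n, Function.Injective (vert n))
    (nat : ∀ (n m : ℕ) (φ : SimplexCategory.mk n ⟶ SimplexCategory.mk m) (t) (i : Fin (n + 1)),
      vert n (X.left.map φ.op t) i = vert m t (φ.toOrderHom i))
    (v : E) (hpt : ∃ t, vert 0 t = fun _ => v)
    (hcons : ∀ n t, ∃ t', vert (n + 1) t' = Fin.cons v (vert n t)) :
    Nonempty X.ExtraDegeneracy := by
  obtain ⟨p, hp⟩ := hpt
  choose s hs using hcons
  refine ⟨{ s' := TypeCat.ofHom fun _ => p
            s := fun n => TypeCat.ofHom (s n)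
            s'_comp_ε := ?_
            s₀_comp_δ₁ := ?_
            s_comp_δ₀ := fun n => ?_
            s_comp_δ := fun n i => ?_
            s_comp_σ := fun n i => ?_ }⟩
  · ext x
    exact Subsingleton.elim (α := X.right) _ _
  · ext t
    refine inj 0 (funext fun j => ?_)
    refine (nat 0 1 (SimplexCategory.δ 1) (s 0 t) j).trans ?_
    refine Eq.trans ?_ (congrFun hp j).symm
    have hj : j = 0 := Subsingleton.elim (α := Fin 1) _ _
    rw [hs, hj]
    rfl
  · ext t
    refine inj n (funext fun j => ?_)
    refine (nat n (n + 1) (SimplexCategory.δ 0) (s n t) j).trans ?_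
    rw [hs]
    rfl
  · ext t
    refine inj (n + 1) (funext fun j => ?_)
    refine (nat (n + 1) (n + 2) (SimplexCategory.δ i.succ) (s (n + 1) t) j).trans ?_
    refine Eq.trans ?_ (congrFun (hs n _) j).symm
    rw [hs]
    -- The coface `δ (i + 1)` fixes the index `0` and acts as `δ i` on the later ones, so it leaves
    -- the added vertex in place.
    refine Fin.cases ?_ (fun j => ?_) j
    · change (Fin.cons v (vert (n + 1) t) : Fin (n + 3) → E) (i.succ.succAbove 0) = _
      rw [Fin.succ_succAbove_zero]
      rfl
    · change (Fin.cons v (vert (n + 1) t) : Fin (n + 3) → E) (i.succ.succAbove j.succ) = _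
      rw [Fin.succ_succAbove_succ, Fin.cons_succ, Fin.cons_succ]
      exact (nat n (n + 1) (SimplexCategory.δ i) t j).symm
  · ext t
    refine inj (n + 2) (funext fun j => ?_)
    refine (nat (n + 2) (n + 1) (SimplexCategory.σ i.succ) (s n t) j).trans ?_
    refine Eq.trans ?_ (congrFun (hs (n + 1) _) j).symm
    rw [hs]
    refine Fin.cases ?_ (fun j => ?_) j
    · change (Fin.cons v (vert n t) : Fin (n + 2) → E) (i.succ.predAbove 0) = _
      rw [Fin.predAbove_right_zero]
      rfl
    · change (Fin.cons v (vert n t) : Fin (n + 2) → E) (i.succ.predAbove j.succ) = _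
      rw [Fin.succ_predAbove_succ, Fin.cons_succ, Fin.cons_succ]
      exact (nat (n + 1) n (SimplexCategory.σ i) t j).symm

/-- After evaluation at `j`, the extra degeneracy makes the augmentation a homotopy equivalence. The
extra degeneracies need not be natural in `j`, and in the applications the vertex put in front does
depend on it. The rest of the proof identifies the evaluated augmentation with the augmentation of
the evaluated object. -/
theorem CategoryTheory.SimplicialObject.Augmented.quasiIso_ε_of_extraDegeneracy
    {J : Type*} [Category* J] {D : Type*} [Category* D] [Abelian D]
    (X : SimplicialObject.Augmented (J ⥤ D))
    (h : ∀ j, Nonempty (SimplicialObject.Augmented.ExtraDegeneracy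
      (((SimplicialObject.Augmented.whiskering _ _).obj ((evaluation J D).obj j)).obj X))) :
    QuasiIso (AlgebraicTopology.AlternatingFaceMapComplex.ε.app X) := by
  refine quasiIso_of_evaluation _ fun j => ?_
  obtain ⟨ed⟩ := h j
  let X' := ((SimplicialObject.Augmented.whiskering _ _).obj ((evaluation J D).obj j)).obj X
  have : QuasiIso (AlgebraicTopology.AlternatingFaceMapComplex.ε.app X') :=
    inferInstanceAs (QuasiIso ed.homotopyEquiv.hom)
  let e₁ : AlgebraicTopology.AlternatingFaceMapComplex.obj
      (SimplicialObject.Augmented.drop.obj X') ≅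
      (((evaluation J D).obj j).mapHomologicalComplex _).obj
        (AlgebraicTopology.AlternatingFaceMapComplex.obj
          (SimplicialObject.Augmented.drop.obj X)) :=
    HomologicalComplex.Hom.isoOfComponents (fun n => Iso.refl _) (by
      rintro _ n rfl
      refine (Category.id_comp _).trans (Eq.trans ?_ (Category.comp_id _).symm)
      rw [AlgebraicTopology.AlternatingFaceMapComplex.obj_d_eq]
      refine (congrArg ((evaluation J D).obj j).map
        (AlgebraicTopology.AlternatingFaceMapComplex.obj_d_eq _ n)).trans ?_
      rw [Functor.map_sum]
      refine Finset.sum_congr rfl fun i _ => ?_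
      rw [Functor.map_zsmul]
      rfl)
  let e₂ : (ChainComplex.single₀ D).obj (SimplicialObject.Augmented.point.obj X') ≅
      (((evaluation J D).obj j).mapHomologicalComplex _).obj
        ((ChainComplex.single₀ _).obj (SimplicialObject.Augmented.point.obj X)) :=
    ((HomologicalComplex.singleMapHomologicalComplex ((evaluation J D).obj j)
      (ComplexShape.down ℕ) 0).app _).symm
  let m := (((evaluation J D).obj j).mapHomologicalComplex (ComplexShape.down ℕ)).map
    (AlgebraicTopology.AlternatingFaceMapComplex.ε.app X)
  have w : (e₁.hom ≫ m) ≫ e₂.inv = AlgebraicTopology.AlternatingFaceMapComplex.ε.app X' := by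
    refine HomologicalComplex.to_single_hom_ext ?_
    refine Eq.trans ?_ (AlgebraicTopology.AlternatingFaceMapComplex.ε_app_f_zero X').symm
    have h₁ : (e₁.hom ≫ m).f 0 = (X.hom.app (op (SimplexCategory.mk 0))).app j := by
      refine (Category.id_comp _).trans ?_
      exact congrArg ((evaluation J D).obj j).map
        (AlgebraicTopology.AlternatingFaceMapComplex.ε_app_f_zero X)
    have h₂ : e₂.inv.f 0 = 𝟙 _ := by
      refine (HomologicalComplex.singleMapHomologicalComplex_hom_app_self _ _ _ _).trans ?_
      exact (Category.comp_id (obj := D) _).trans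
        (((evaluation J D).obj j).map_id (SimplicialObject.Augmented.point.obj X))
    refine (congrArg₂ (fun f g => CategoryStruct.comp (obj := D) f g) h₁ h₂).trans ?_
    refine (Category.comp_id (obj := D)
      ((X.hom.app (op (SimplexCategory.mk 0))).app j)).trans ?_
    exact (Category.comp_id (obj := D) ((X.hom.app (op (SimplexCategory.mk 0))).app j)).symm
  exact quasiIso_of_arrow_mk_iso (AlgebraicTopology.AlternatingFaceMapComplex.ε.app X') m
    (Arrow.isoMk e₁ e₂ ((Iso.comp_inv_eq e₂).1 w))

namespace PosetCech

/-! ### Projectivity of free presheaves with basic supports -/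

section Projective

variable {A : Type u} [PartialOrder A] {K L : SSet.{u}}

/-- Since `β` is the greatest element of `U^β`, a coherent family there is determined by its
component at `β`. That component is lifted along the surjection `e` at `β` and then restricted. -/
theorem exists_coherent_lift {E G : Aᵒᵖ ⥤ AddCommGrpCat.{u}} (e : E ⟶ G) [Epi e] (β : A)
    (c : coherent G (basicOpen β)) : ∃ d : coherent E (basicOpen β),
      ∀ α, e.app (op α.1) (d.1 α) = c.1 α := by
  have hβ : Topology.WithLowerSet.toLowerSet β ∈ basicOpen β := le_refl β
  obtain ⟨y, hy⟩ := (AddCommGrpCat.epi_iff_surjective (e.app (op β))).1 inferInstance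
    (c.1 ⟨β, hβ⟩)
  refine ⟨⟨fun α => E.map (homOfLE (show α.1 ≤ β from α.2)).op y, fun α α' f => ?_⟩, fun α => ?_⟩
  · rw [← ConcreteCategory.comp_apply, ← E.map_comp]
    rfl
  · rw [NatTrans.naturality_apply e, hy]
    exact c.2 α ⟨β, hβ⟩ _

/-- A simplex with support `U^β` contributes the free presheaf on a representable, so lifts can be
chosen independently for each simplex. -/
theorem projective_freeSupport (σ : K.Elements ⥤ Opens (upperSpace A)) (n : SimplexCategoryᵒᵖ)
    (h : ∀ s : K.obj n, ∃ β, σ.obj (K.elementsMk n s) = basicOpen β) :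
    Projective ((freeSupport σ).obj n) where
  factors {E G} f e _ := by
    have key (s : K.obj n) (c : coherent G (σ.obj (K.elementsMk n s))) :
        ∃ d : coherent E (σ.obj (K.elementsMk n s)), ∀ α, e.app (op α.1) (d.1 α) = c.1 α := by
      obtain ⟨β, hβ⟩ := h s
      revert c
      rw [hβ]
      exact exists_coherent_lift e β
    choose d hd using fun s => key s ((freeSupportHomEquiv σ G n).symm f s)
    refine ⟨freeSupportHomEquiv σ E n d, freeSupport_hom_ext fun s β hs => ?_⟩
    refine (congrArg (e.app (op β)) (freeSupportHomEquiv_app_generator σ E n d s β hs)).trans ?_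
    exact hd s ⟨β, hs⟩

end Projective

/-! ### The Čech and nerve chains as resolutions of `ℤ` -/

section Resolution

variable {A : Type u} [PartialOrder A] {K L : SSet.{u}}

/-- The augmentation of `supportPresheaf σ` to the terminal presheaf. -/
def supportAugmented (σ : K.Elements ⥤ Opens (upperSpace A)) :
    SimplicialObject.Augmented (Aᵒᵖ ⥤ Type u) where
  left := supportPresheaf σ
  right := (Functor.const _).obj PUnit
  hom := { app := fun _ => { app := fun _ => TypeCat.ofHom fun _ => PUnit.unit } }

/-- The augmented simplicial presheaf of free abelian groups on `supportAugmented σ`. -/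
abbrev freeAugmented (σ : K.Elements ⥤ Opens (upperSpace A)) :
    SimplicialObject.Augmented (Aᵒᵖ ⥤ AddCommGrpCat.{u}) :=
  ((SimplicialObject.Augmented.whiskering _ _).obj ((Functor.whiskeringRight _ _ _).obj
    AddCommGrpCat.free)).obj (supportAugmented σ)

variable (A) in
/-- The constant presheaf `ℤ`, as the free abelian presheaf on the terminal presheaf. -/
abbrev freePoint : Aᵒᵖ ⥤ AddCommGrpCat.{u} :=
  (Functor.const Aᵒᵖ).obj PUnit ⋙ AddCommGrpCat.free

/-- The augmentation `chains σ ⟶ ℤ`. -/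
def augmentation (σ : K.Elements ⥤ Opens (upperSpace A)) :
    chains σ ⟶ (ChainComplex.single₀ _).obj (freePoint A) :=
  AlgebraicTopology.AlternatingFaceMapComplex.ε.app (freeAugmented σ)

theorem augmentation_app_generator (σ : K.Elements ⥤ Opens (upperSpace A))
    (s : K.obj (op (SimplexCategory.mk 0))) (β : A) (hs) :
    (show (freeSupport σ).obj (op (SimplexCategory.mk 0)) ⟶ freePoint A from
      (augmentation σ).f 0).app (op β) (generator σ s β hs) = FreeAbelianGroup.of PUnit.unit := by
  have h : (augmentation σ).f 0 = (freeAugmented σ).hom.app (op (SimplexCategory.mk 0)) :=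
    AlgebraicTopology.AlternatingFaceMapComplex.ε_app_f_zero _
  rw [h]
  exact FreeAbelianGroup.map_of_apply _

/-- The augmentation sends every vertex to the generator of `ℤ`, and a simplicial map sends vertices
to vertices. -/
theorem chainsMap_augmentation (f : K ⟶ L) {σ : K.Elements ⥤ Opens (upperSpace A)}
    {τ : L.Elements ⥤ Opens (upperSpace A)} (i : σ ⟶ elementsMap f ⋙ τ) :
    chainsMap f i ≫ augmentation τ = augmentation σ := by
  refine HomologicalComplex.to_single_hom_ext ?_
  refine freeSupport_hom_ext (G := freePoint A) fun s β hs => ?_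
  refine Eq.trans ?_ (augmentation_app_generator σ s β hs).symm
  refine (congrArg ((show (freeSupport τ).obj (op (SimplexCategory.mk 0)) ⟶ freePoint A from
    (augmentation τ).f 0).app (op β)) (chainsMap_f_app_generator f i 0 s β hs)).trans ?_
  exact augmentation_app_generator τ _ β _

/-- The simplicial set of the simplices of `K` whose support contains `β`. -/
abbrev supportAt (σ : K.Elements ⥤ Opens (upperSpace A)) (β : A) :
    SimplicialObject.Augmented (Type u) :=
  ((SimplicialObject.Augmented.whiskering _ _).obj ((evaluation _ _).obj (op β))).obj
    (supportAugmented σ)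

theorem quasiIso_augmentation (σ : K.Elements ⥤ Opens (upperSpace A))
    (h : ∀ β, Nonempty (supportAt σ β).ExtraDegeneracy) : QuasiIso (augmentation σ) :=
  SimplicialObject.Augmented.quasiIso_ε_of_extraDegeneracy (freeAugmented σ) fun β =>
    (h β.unop).map fun ed => ed.map AddCommGrpCat.free

/-- `chains σ` as a projective resolution. -/
def chainsResolution (σ : K.Elements ⥤ Opens (upperSpace A))
    (hproj : ∀ (n : ℕ) (s : K.obj (op (SimplexCategory.mk n))),
      ∃ β, σ.obj (K.elementsMk _ s) = basicOpen β) (hq : QuasiIso (augmentation σ)) :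
    ProjectiveResolution (freePoint A) where
  complex := chains σ
  projective n := projective_freeSupport σ _ (hproj n)
  π := augmentation σ
  quasiIso := hq

/-- Over `β` the simplices are all finite sequences of members of `U` containing `β`; the non-empty
intersection is automatic, `β` being a point of it. Any fixed member `W` containing `β` can be put
in front. No meets in `A` are needed, so this holds for every covering. -/
theorem quasiIso_augmentation_coverInter (U : OpenCovering (upperSpace A)) :
    QuasiIso (augmentation (coverInter U)) := by
  refine quasiIso_augmentation _ fun β => ?_
  obtain ⟨W, hW, hβ⟩ := U.covers (Topology.WithLowerSet.toLowerSet β)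
  have hmem {n : ℕ} (s : Fin (n + 1) → U.sets)
      (hs : ∀ i, Topology.WithLowerSet.toLowerSet β ∈ (s i : Opens (upperSpace A))) :
      ∃ t : (supportAt (coverInter U) β).left.obj (op (SimplexCategory.mk n)), t.1.1 = s := by
    refine ⟨⟨⟨s, _, hs⟩, ?_⟩, rfl⟩
    change _ ∈ ⨅ i, (s i : Opens (upperSpace A))
    rw [← SetLike.mem_coe, Opens.coe_iInf, Set.mem_iInter]
    exact hs
  have hmem' {n : ℕ} (t : (supportAt (coverInter U) β).left.obj (op (SimplexCategory.mk n)))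
      (i : Fin (n + 1)) : Topology.WithLowerSet.toLowerSet β ∈ (t.1.1 i : Opens (upperSpace A)) :=
    iInf_le (fun i => (t.1.1 i : Opens (upperSpace A))) i t.2
  have : Subsingleton (supportAt (coverInter U) β).right :=
    inferInstanceAs (Subsingleton PUnit)
  refine SimplicialObject.Augmented.nonempty_extraDegeneracy_of_cons _
    (E := U.sets) (fun n t => t.1.1) (fun n t t' h => Subtype.ext (Subtype.ext h))
    (fun n m φ t i => rfl) ⟨W, hW⟩ (hmem _ fun _ => hβ) fun n t => hmem _ fun i => ?_
  refine Fin.cases ?_ (fun i => ?_) i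
  · exact hβ
  · exact hmem' t i

variable (A) in
/-- `β ↦ U^β` as a functor. -/
def basicOpenFunctor : A ⥤ Opens (upperSpace A) where
  obj := basicOpen
  map f := homOfLE fun _ h => le_trans h f.le

variable (A) in
/-- The support `U^{α_0}` of a simplex `α_0 ⟶ … ⟶ α_n` of the nerve. -/
abbrev nerveSupport : (nerve A).Elements ⥤ Opens (upperSpace A) := nerveFirst A ⋙ basicOpenFunctor A

theorem nerve_ext_vertex {n : SimplexCategoryᵒᵖ} {a b : (nerve A).obj n}
    (h : ∀ i, vertex a i = vertex b i) : a = b :=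
  CategoryTheory.Functor.ext h fun _ _ _ => Subsingleton.elim _ _

/-- The simplex of the nerve with a given monotone sequence of vertices. -/
def nerveMk {n : ℕ} (v : Fin (n + 1) → A) (hv : Monotone v) :
    (nerve A).obj (op (SimplexCategory.mk n)) :=
  hv.functor

/-- Over `β` the simplices are the chains `α_0 ≤ … ≤ α_n` with `β ≤ α_0`, and `β` itself can be put
in front. -/
theorem quasiIso_augmentation_nerveSupport : QuasiIso (augmentation (nerveSupport A)) := by
  refine quasiIso_augmentation _ fun β => ?_
  have : Subsingleton (supportAt (nerveSupport A) β).right :=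
    inferInstanceAs (Subsingleton PUnit)
  have hmem {n : ℕ} (v : Fin (n + 1) → A) (hv : Monotone v) (h : β ≤ v 0) :
      ∃ t : (supportAt (nerveSupport A) β).left.obj (op (SimplexCategory.mk n)),
        vertex t.1 = v := ⟨⟨nerveMk v hv, h⟩, rfl⟩
  refine SimplicialObject.Augmented.nonempty_extraDegeneracy_of_cons _
    (E := A) (fun n t => vertex t.1)
    (fun n t t' h => Subtype.ext (nerve_ext_vertex fun i => congrFun h i))
    (fun n m φ t i => rfl) β (hmem _ monotone_const le_rfl) fun n t => hmem _ ?_ le_rfl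
  refine Fin.monotone_iff_le_succ.2 fun i => ?_
  refine Fin.cases ?_ (fun i => ?_) i
  · exact t.2
  · exact (CategoryTheory.Functor.map (C := Fin (n + 1)) t.1
      (homOfLE (Fin.castSucc_le_succ i))).le

variable (A) in
/-- The chains on the nerve of `A` are a projective resolution of `ℤ`. -/
def nerveResolution : ProjectiveResolution (freePoint A) :=
  chainsResolution (nerveSupport A) (fun _ s => ⟨vertex s 0, rfl⟩)
    quasiIso_augmentation_nerveSupport

/-- The meet of `v 0` with the meet of the remaining entries. The common lower bound `ω` is carried
through the induction because binary meets exist only in its presence. -/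
theorem HasConditionalProducts.exists_isGLB_range (hA : HasConditionalProducts A) (n : ℕ)
    (v : Fin (n + 1) → A) (ω : A) (hω : ∀ i, ω ≤ v i) : ∃ β, IsGLB (Set.range v) β := by
  induction n with
  | zero =>
    refine ⟨v 0, ?_, fun δ hδ => hδ ⟨0, rfl⟩⟩
    rintro _ ⟨i, rfl⟩
    exact le_of_eq (congrArg v (Subsingleton.elim (α := Fin 1) _ _))
  | succ n ih =>
    obtain ⟨β, hβ⟩ := ih (fun i => v i.succ) fun i => hω _
    obtain ⟨γ, hγ⟩ := hA (v 0) β ω (hω 0) (hβ.2 (by rintro _ ⟨i, rfl⟩; exact hω _))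
    refine ⟨γ, ?_, fun δ hδ => hγ.2 ?_⟩
    · rintro _ ⟨i, rfl⟩
      refine Fin.cases ?_ (fun i => ?_) i
      · exact hγ.1 (by simp)
      · exact (hγ.1 (by simp)).trans (hβ.1 ⟨i, rfl⟩)
    · rintro _ (rfl | rfl)
      · exact hδ ⟨0, rfl⟩
      · exact hβ.2 (by rintro _ ⟨i, rfl⟩; exact hδ ⟨i.succ, rfl⟩)

/-- A point of the intersection is a common lower bound of the indices, so their meet `β` exists.
Being below every index is the same as being below `β`. -/
theorem HasConditionalProducts.exists_coverInter_eq (hA : HasConditionalProducts A) (n : ℕ)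
    (s : (coverNerve (canonicalCovering A)).obj (op (SimplexCategory.mk n))) :
    ∃ β, (coverInter (canonicalCovering A)).obj
      ((coverNerve (canonicalCovering A)).elementsMk _ s) = basicOpen β := by
  obtain ⟨s, x, hx⟩ := s
  choose v hv using fun i => (s i).2
  obtain ⟨β, hβ⟩ := hA.exists_isGLB_range n v (Topology.WithLowerSet.ofLowerSet x) fun i => by
    have := hx i
    rw [← hv i] at this
    exact this
  refine ⟨β, ?_⟩
  ext α
  change α ∈ ((⨅ i, (s i : Opens (upperSpace A)) : Opens (upperSpace A)) : Set _) ↔ _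
  rw [Opens.coe_iInf, Set.mem_iInter]
  refine ⟨fun h => hβ.2 ?_, fun h i => ?_⟩
  · rintro _ ⟨i, rfl⟩
    have := h i
    rw [← hv i] at this
    exact this
  · rw [← hv i]
    exact le_trans h (hβ.1 ⟨i, rfl⟩)

/-- The chains on the canonical covering are a projective resolution of `ℤ`. -/
def cechResolution (hA : HasConditionalProducts A) : ProjectiveResolution (freePoint A) :=
  chainsResolution (coverInter (canonicalCovering A)) hA.exists_coverInter_eq
    (quasiIso_augmentation_coverInter _)

end Resolution

end PosetCech

/-! ### Colimits attained at a weakly terminal object -/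

/-- The maps `F.map (r j)` form a cocone with vertex `F.obj c` because all parallel arrows into `c`
agree under `F`. The map induced from the colimit is the inverse. -/
theorem CategoryTheory.Limits.isIso_colimit_ι_of_weaklyTerminal {J : Type*} [Category* J]
    {D : Type*} [Category* D] (F : J ⥤ D) [HasColimit F] (c : J) (r : ∀ j, j ⟶ c)
    (hr : ∀ (j : J) (p q : j ⟶ c), F.map p = F.map q) : IsIso (colimit.ι F c) := by
  let t : Cocone F :=
    { pt := F.obj c
      ι :=
        { app := fun j => F.map (r j)
          naturality := fun i j f => by
            dsimp
            rw [← F.map_comp, Category.comp_id]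
            exact hr _ _ _ } }
  refine ⟨colimit.desc F t, ?_, ?_⟩
  · rw [colimit.ι_desc]
    exact (hr c (r c) (𝟙 c)).trans (F.map_id c)
  · refine colimit.hom_ext fun j => ?_
    rw [colimit.ι_desc_assoc, Category.comp_id]
    exact colimit.w F (r j)

theorem CategoryTheory.comp_inv_comp_eq_of_squares {C : Type*} [Category* C]
    {X X' Y Y' Z Z' : C} {a : X ⟶ Y} {a' : X' ⟶ Y'} {b : X ⟶ Z} {b' : X' ⟶ Z'} {f : X ⟶ X'}
    {g : Y ⟶ Y'} {k : Z ⟶ Z'} (_ : IsIso a) (_ : IsIso a') (h : a ≫ g = f ≫ a') (h' : f ≫ b' = b ≫ k) :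
    g ≫ inv a' ≫ b' = (inv a ≫ b) ≫ k := by
  rw [← cancel_epi a, reassoc_of% h, IsIso.hom_inv_id_assoc, h', Category.assoc,
    IsIso.hom_inv_id_assoc]

namespace PosetCech

/-! ### The comparison isomorphisms -/

section Comparison

variable {A : Type u} [PartialOrder A]

variable (A) in
/-- The inclusions `U^{α_0} ⊆ U^{α_0} ∩ … ∩ U^{α_n}`. -/
def compareInter : nerveSupport A ⟶ elementsMap (compareNerve A) ⋙
    coverInter (canonicalCovering A) where
  app a := homOfLE fun _ h => mem_of_le _ h (vertex_zero_mem a.2)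

/-- The isomorphism `Ĝ(U^α) ≅ G(α)`. -/
def inducedPresheafBasicOpenIso (G : Aᵒᵖ ⥤ AddCommGrpCat.{u}) :
    (basicOpenFunctor A).op ⋙ inducedPresheaf G ≅ G :=
  NatIso.ofComponents (fun α => AddEquiv.toAddCommGrpIso
    { toFun := fun s : coherent G (basicOpen α.unop) => s.1 ⟨α.unop, le_refl α.unop⟩
      invFun := fun x => (⟨fun β => G.map (homOfLE (show β.1 ≤ α.unop from β.2)).op x,
        fun β γ f => by
          rw [← ConcreteCategory.comp_apply, ← G.map_comp]
          rfl⟩ : coherent G (basicOpen α.unop))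
      left_inv := fun s => Subtype.ext (funext fun β => s.2 β ⟨α.unop, le_refl α.unop⟩ _)
      right_inv := fun x => ConcreteCategory.congr_hom (G.map_id α) x
      map_add' := fun _ _ => rfl }) fun {α β} f => by
    ext s
    exact (s.2 ⟨β.unop, f.unop.le⟩ ⟨α.unop, le_refl α.unop⟩ f.unop).symm

/-- The nerve complex as the cochain complex of `Ĝ(U^{α_0})`. -/
def nerveInducedIso (G : Aᵒᵖ ⥤ AddCommGrpCat.{u}) :
    (cochainFunctor (nerve A)).obj ((nerveSupport A).op ⋙ inducedPresheaf G) ≅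
      (nerveComplex A).obj G :=
  (cochainFunctor (nerve A)).mapIso
    (Functor.isoWhiskerLeft (nerveFirst A).op (inducedPresheafBasicOpenIso G))

/-- The nerve complex is `Hom(chains, G)`. -/
def nerveHomIso (G : Aᵒᵖ ⥤ AddCommGrpCat.{u}) :
    (nerveComplex A).obj G ≅ (chains (nerveSupport A)).homComplex G :=
  (nerveInducedIso G).symm ≪≫ cochainIso (nerveSupport A) G

variable (A) in
/-- The nerve complex is `Hom(chains, G)`, naturally in `G`. -/
def nerveHomNatIso : nerveComplex A ≅ (chains (nerveSupport A)).homComplexFunctor :=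
  NatIso.ofComponents nerveHomIso fun {G G'} t => by
    have h : (nerveInducedIso G).hom ≫ (nerveComplex A).map t =
        (cochainFunctor (nerve A)).map (Functor.whiskerLeft (nerveSupport A).op
          (inducedPresheafMap t)) ≫ (nerveInducedIso G').hom := by
      ext n c
      rfl
    have h₁ : (nerveComplex A).map t ≫ (nerveInducedIso G').inv = (nerveInducedIso G).inv ≫
        (cochainFunctor (nerve A)).map (Functor.whiskerLeft (nerveSupport A).op
          (inducedPresheafMap t)) := by
      rw [Iso.comp_inv_eq, Category.assoc, Iso.eq_inv_comp]
      exact h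
    change (nerveComplex A).map t ≫ (nerveInducedIso G').inv ≫
      (cochainIso (nerveSupport A) G').hom = ((nerveInducedIso G).inv ≫
      (cochainIso (nerveSupport A) G).hom) ≫ (chains (nerveSupport A)).homComplexPostcomp t
    rw [← Category.assoc, h₁, Category.assoc, Category.assoc]
    exact congrArg ((nerveInducedIso G).inv ≫ ·) (cochainIso_hom_naturality (nerveSupport A) t)

/-- Taking the component at `α_0` is the same as restricting to `U^{α_0}` and then using `Ĝ(U^{α_0})
≅ G(α_0)`. This brings `j^*` into the form of a map induced by an inclusion of supports. -/
theorem compareMap_eq (G : Aᵒᵖ ⥤ AddCommGrpCat.{u}) :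
    compareMap G = cochainMap (compareNerve A)
      (G := (coverInter (canonicalCovering A)).op ⋙ inducedPresheaf G)
      (F := (nerveSupport A).op ⋙ inducedPresheaf G)
      (Functor.whiskerRight (NatTrans.op (compareInter A)) (inducedPresheaf G)) ≫
        (nerveInducedIso G).hom := by
  ext n c
  rfl

theorem exists_homotopyEquiv_hom_eq_compareMap (hA : HasConditionalProducts A)
    (G : Aᵒᵖ ⥤ AddCommGrpCat.{u}) :
    ∃ e : HomotopyEquiv ((cechComplex (canonicalCovering A)).obj (inducedSheaf.obj G).obj)
      ((nerveComplex A).obj G), e.hom = compareMap G := by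
  -- On chains, `j` goes from the nerve to the covering; `Hom(-, G)` reverses it into `j^*`.
  obtain ⟨e, he⟩ := (nerveResolution A).exists_homotopyEquiv_hom_eq (cechResolution hA)
    (chainsMap (compareNerve A) (compareInter A)) (chainsMap_augmentation _ _)
  let e₁ := HomotopyEquiv.ofIso (cochainIso (coverInter (canonicalCovering A)) G)
  let e₂ := HomotopyEquiv.ofIso (nerveHomIso G).symm
  refine ⟨(e₁.trans (ChainComplex.homComplexHomotopyEquiv e G)).trans e₂, ?_⟩
  change ((cochainIso (coverInter (canonicalCovering A)) G).hom ≫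
    ChainComplex.homComplexPrecomp e.hom G) ≫ (cochainIso (nerveSupport A) G).inv ≫
      (nerveInducedIso G).hom = _
  have h := cochainMap_comp_cochainIso_hom (compareNerve A) (compareInter A) G
  rw [← Iso.eq_comp_inv] at h
  refine Eq.trans ?_ (compareMap_eq G).symm
  refine Eq.trans ?_ (congrArg (· ≫ (nerveInducedIso G).hom) h.symm)
  refine (Category.assoc _ _ _).symm.trans ?_
  exact congrArg (fun f => (((cochainIso (coverInter (canonicalCovering A)) G).hom ≫
    ChainComplex.homComplexPrecomp f G) ≫ (cochainIso (nerveSupport A) G).inv) ≫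
      (nerveInducedIso G).hom) he

theorem isIso_homologyMap_compareMap (hA : HasConditionalProducts A)
    (G : Aᵒᵖ ⥤ AddCommGrpCat.{u}) (n : ℕ) : IsIso (homologyMap (compareMap G) n) := by
  obtain ⟨e, he⟩ := exists_homotopyEquiv_hom_eq_compareMap hA G
  rw [← he]
  infer_instance

/-- Every covering is refined by the canonical one. -/
def projectionToCanonical (U : OpenCovering (upperSpace A)) : U ⟶ canonicalCovering A where
  -- For `W = U^α`, any member of `U` that contains the point `α` contains all of `U^α`, since open
  -- sets are closed downwards.
  toFun W := ⟨_, (U.covers (Topology.WithLowerSet.toLowerSet W.2.choose)).choose_spec.1⟩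
  subset W := by
    intro x hx
    rw [← W.2.choose_spec] at hx
    exact mem_of_le _ hx (U.covers (Topology.WithLowerSet.toLowerSet W.2.choose)).choose_spec.2

/-- Both projections induce chain maps from the chains of the canonical covering to those of `U`,
compatible with the augmentations. The source is projective by `hA` and the target is a resolution,
so the two maps are homotopic, and they stay so after `Hom(-, G)`. -/
theorem cechDiagram_map_eq (hA : HasConditionalProducts A) (G : Aᵒᵖ ⥤ AddCommGrpCat.{u}) (n : ℕ)
    (U : OpenCovering (upperSpace A)) (p q : U ⟶ canonicalCovering A) :
    ((cechDiagram (upperSpace A) n).obj (inducedSheaf.obj G).obj).map p =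
      ((cechDiagram (upperSpace A) n).obj (inducedSheaf.obj G).obj).map q := by
  have : QuasiIso (augmentation (coverInter U)) := quasiIso_augmentation_coverInter U
  have : ∀ n, Projective ((chains (coverInter (canonicalCovering A))).X n) :=
    (cechResolution hA).projective
  obtain ⟨h⟩ := ChainComplex.nonempty_homotopy_of_projective (augmentation (coverInter U))
    (chainsMap (projNerve p) (projInter p)) (chainsMap (projNerve q) (projInter q))
    ((chainsMap_augmentation _ _).trans (chainsMap_augmentation _ _).symm)
  have hpq := (ChainComplex.homComplexHomotopy h G).homologyMap_eq n
  have key (p : U ⟶ canonicalCovering A) :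
      homologyMap (cochainMap (projNerve p) (projLift p (inducedSheaf.obj G).obj)) n =
        homologyMap (cochainIso (coverInter U) G).hom n ≫
          homologyMap (ChainComplex.homComplexPrecomp (chainsMap (projNerve p) (projInter p)) G) n ≫
            homologyMap (cochainIso (coverInter (canonicalCovering A)) G).inv n := by
    rw [← homologyMap_comp, ← homologyMap_comp]
    congr 1
    rw [← Category.assoc]
    refine (Iso.eq_comp_inv _).2 ?_
    exact cochainMap_comp_cochainIso_hom (projNerve p) (projInter p) G
  exact (key p).trans ((congrArg (fun f => _ ≫ f ≫ _) hpq).trans (key q).symm)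

theorem isIso_toCechCohomology_canonicalCovering (hA : HasConditionalProducts A)
    (G : Aᵒᵖ ⥤ AddCommGrpCat.{u}) (n : ℕ) :
    IsIso (toCechCohomology (canonicalCovering A) (inducedSheaf.obj G).obj n) :=
  isIso_colimit_ι_of_weaklyTerminal _ _ projectionToCanonical
    fun U p q => cechDiagram_map_eq hA G n U p q

variable (A) in
/-- The two descriptions of the constant presheaf `ℤ`. -/
def freePointIso : freePoint A ≅ (Functor.const Aᵒᵖ).obj (AddCommGrpCat.of (ULift.{u} ℤ)) :=
  NatIso.ofComponents (fun _ => ((FreeAbelianGroup.uniqueEquiv PUnit).trans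
    AddEquiv.ulift.symm).toAddCommGrpIso) fun _ =>
      AddCommGrpCat.hom_ext (FreeAbelianGroup.lift_ext _ _ fun _ => rfl)

variable (A) in
/-- The cohomology of the nerve complex is the topos cohomology. -/
def nerveCohomologyIsoTopos (n : ℕ) : nerveCohomology A n ≅ toposCohomology A n :=
  Functor.isoWhiskerRight (nerveHomNatIso A) _ ≪≫ (nerveResolution A).homologyIsoExt n ≪≫
    (extFunctor n).mapIso (freePointIso A).symm.op

theorem compareMap_naturality {G G' : Aᵒᵖ ⥤ AddCommGrpCat.{u}} (t : G ⟶ G') :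
    (cechComplex (canonicalCovering A)).map (inducedSheaf.map t).hom ≫ compareMap G' =
      compareMap G ≫ (nerveComplex A).map t := by
  ext n c
  rfl

/-- The Čech cohomology of `X^A` is the cohomology of the nerve complex. -/
def cechCohomologyIsoNerve (hA : HasConditionalProducts A) (n : ℕ) :
    inducedSheaf ⋙ TopCat.Sheaf.forget AddCommGrpCat.{u} (upperSpace A) ⋙
      cechCohomology (upperSpace A) n ≅ nerveCohomology A n :=
  NatIso.ofComponents (fun G =>
    (@asIso _ _ _ _ _ (isIso_toCechCohomology_canonicalCovering hA G n)).symm ≪≫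
      @asIso _ _ _ _ _ (isIso_homologyMap_compareMap hA G n)) fun {G G'} t => by
    have h : toCechCohomology (canonicalCovering A) (inducedSheaf.obj G).obj n ≫
        (cechCohomology (upperSpace A) n).map (inducedSheaf.map t).hom =
        homologyMap ((cechComplex (canonicalCovering A)).map (inducedSheaf.map t).hom) n ≫
          toCechCohomology (canonicalCovering A) (inducedSheaf.obj G').obj n :=
      ι_colimMap _ _
    have h' := congrArg (fun f => homologyMap f n) (compareMap_naturality t)
    simp only [homologyMap_comp] at h'
    exact comp_inv_comp_eq_of_squares (isIso_toCechCohomology_canonicalCovering hA G n)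
      (isIso_toCechCohomology_canonicalCovering hA G' n) h h'

end Comparison

end PosetCech

end

/-! ### The theorem -/

open PosetCech
theorem corollary6 (A : Type u) [PartialOrder A] (hA : HasConditionalProducts A) :
    (∀ G : Aᵒᵖ ⥤ AddCommGrpCat.{u},
      (∃ e : HomotopyEquiv ((cechComplex (canonicalCovering A)).obj (inducedSheaf.obj G).obj)
          ((nerveComplex A).obj G), e.hom = compareMap G) ∧
      ∀ n : ℕ, IsIso (HomologicalComplex.homologyMap (compareMap G) n)) ∧
    ∀ n : ℕ,
      (∃ e : inducedSheaf ⋙ TopCat.Sheaf.forget AddCommGrpCat.{u} (upperSpace A) ⋙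
            cechCohomology (upperSpace A) n ≅ nerveCohomology A n,
        ∀ G : Aᵒᵖ ⥤ AddCommGrpCat.{u},
          toCechCohomology (canonicalCovering A) (inducedSheaf.obj G).obj n ≫ e.hom.app G =
            HomologicalComplex.homologyMap (compareMap G) n) ∧
      Nonempty (inducedSheaf ⋙ TopCat.Sheaf.forget AddCommGrpCat.{u} (upperSpace A) ⋙
            cechCohomology (upperSpace A) n ≅ toposCohomology A n) := by
  refine ⟨fun G => ⟨exists_homotopyEquiv_hom_eq_compareMap hA G,
    isIso_homologyMap_compareMap hA G⟩, fun n => ⟨⟨cechCohomologyIsoNerve hA n, fun G => ?_⟩,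
    ⟨cechCohomologyIsoNerve hA n ≪≫ nerveCohomologyIsoTopos A n⟩⟩⟩
  -- The isomorphism is the inverse of the canonical map followed by `H^n(j^*)`, so the canonical
  -- map cancels.
  exact @IsIso.hom_inv_id_assoc _ _ _ _
    (toCechCohomology (canonicalCovering A) (inducedSheaf.obj G).obj n)
    (isIso_toCechCohomology_canonicalCovering hA G n) _
    (HomologicalComplex.homologyMap (compareMap G) n)
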